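/- Let $H$ be a real Hilbert space and let $\Phi:H\to\mathbb R\cup\{\pm\infty\}$ be proper, convex and lower semicontinuous with $\operatorname{argmin}\Phi\neq\emptyset$. Put $\Phi^*=\min\Phi$ and $x^*=\operatorname{proj}_{\operatorname{argmin}\Phi}(0)$. For $\mu>0$ let $\Phi_\mu(x)=\inf_{y\in H}\{\Phi(y)+\frac1{2\mu}\|x-y\|^2\}$ be the Moreau envelope and $\operatorname{prox}_{\mu\Phi}(x)$ the unique minimizer in this infimum. For $e>0$ let $\varphi_{e,\mu}(x)=\Phi_\mu(x)+\frac e2\|x\|^2$ and let $x_{e,\mu}$ be its unique minimizer. Let $\alpha,\beta,t_0>0$, $1\le d<2$, $0\le l<d$, and $\lambda(t)=t^l$, $\varepsilon(t)=t^{-d}$. (1) There is $\gamma$ with $\frac\alpha2<\gamma<\alpha$ and $2\gamma(\alpha-\gamma)<1$. If $d>1$, or if $d=1$ and $\beta<1$, then for every such $\gamma$ there are $a,c>0$ such that $\lim_{t\to+\infty}\lambda(t)\varepsilon(t)=0$ and, for all sufficiently large $t$, $$\frac{d}{dt}\Big(\frac1{\sqrt{\varepsilon(t)}}\Big)\le\min\Big\{2\gamma-\alpha-\frac{\gamma\beta\dot\varepsilon(t)}{2\varepsilon(t)},\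 \alpha-\gamma\frac{a+1}{a}\Big\},$$ $$\Big(2\gamma(\alpha-\gamma)+\frac\gamma c-1\Big)\varepsilon(t)-\beta\dot\varepsilon(t)\le0,$$ $$2\beta\varepsilon^2(t)+\big(2-\gamma\beta\sqrt{\varepsilon(t)}\big)\dot\varepsilon(t)\le0,$$ $$\Big(\frac\gamma a+2(\alpha-\gamma)\Big)\beta^2\sqrt{\varepsilon(t)}-\frac{3\beta^2\dot\varepsilon(t)}{2\varepsilon(t)}-\dot\lambda(t)\le\beta.$$ (2) Let $x:[t_0,+\infty)\to H$ be any strong solution of $$\ddot x(t)+\alpha\sqrt{\varepsilon(t)}\,\dot x(t)+\beta\frac{d}{dt}\big(\nabla\Phi_{\lambda(t)}(x(t))\big)+\nabla\Phi_{\lambda(t)}(x(t))+\varepsilon(t)x(t)=0,$$ that is, $x$ is differentiable, $\dot x$ is locally absolutely continuous, and the equation holds for almost every $t$. For every $\gamma$ with $\frac\alpha2\le\gamma<\alpha$ and $2\gamma(\alpha-\gamma)<1$ let $$E(t)=\varphi_{\varepsilon(t),\lambda(t)}(x(t))-\varphi_{\varepsilon(t),\lambda(t)}(x_{\varepsilon(t),\lambda(t)})+\tfrac12\big\|\gamma\sqrt{\varepsilon(t)}\,(x(t)-x_{\varepsilon(t),\lambda(t)})+\dot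 x(t)+\beta\nabla\Phi_{\lambda(t)}(x(t))\big\|^2 .$$ Then there are $C_3,C_4,C_5>0$ and $t_2\ge t_0$ such that for all $t\ge t_2$ $$E(t)\le\frac{C_3}{t^{d/2+1}},$$ $$\Phi_{\lambda(t)}(x(t))-\Phi^*\le\frac{C_3}{t^{d/2+1}}+\frac{\|x^*\|^2}{2t^d}\quad\text{and}\quad\Phi_{\lambda(t)}(x(t))-\Phi^*\le\frac{C_4}{t^d},$$ $$\Phi\big(\operatorname{prox}_{\lambda(t)\Phi}(x(t))\big)-\Phi^*\le\frac{C_3}{t^{d/2+1}}+\frac{\|x^*\|^2}{2t^d}\quad\text{and}\quad\Phi\big(\operatorname{prox}_{\lambda(t)\Phi}(x(t))\big)-\Phi^*\le\frac{C_4}{t^d},$$ $$\|\operatorname{prox}_{\lambda(t)\Phi}(x(t))-x(t)\|^2\le 2C_3t^{l-d/2-1}+t^{l-d}\|x^*\|^2\quad\text{and}\quad\|\operatorname{prox}_{\lambda(t)\Phi}(x(t))-x(t)\|^2\le\frac{C_5}{t^{d-l}},$$ $$\|x(t)-x_{\varepsilon(t),\lambda(t)}\|^2\le\frac{C_3}{t^{1-d/2}},$$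 and, if $l\le\frac{3d}2-1$ or $x^*=0$, moreover $$\|\operatorname{prox}_{\lambda(t)\Phi}(x(t))-x(t)\|^2\le\frac{C_5}{t^{d/2+1-l}}.$$ Finally, $x(t)\to x^*$ strongly as $t\to+\infty$. -/

import Mathlib

open Set Filter Topology MeasureTheory

namespace TikhonovFlow

/-- A point of `S` at which `f` attains its minimum over `S`.  It is only applied to problems
that have exactly one minimizer. -/
noncomputable def argminOn {X R : Type*} [Nonempty X] [Preorder R] (f : X → R) (S : Set X) : X :=
  Classical.epsilon fun y => y ∈ S ∧ IsMinOn f S y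

section Functionals

variable {H : Type*} [NormedAddCommGroup H] [InnerProductSpace ℝ H]

/-- `Φ` is proper, convex (its epigraph is convex) and lower semicontinuous. -/
structure IsProperConvexLsc (Φ : H → EReal) : Prop where
  ne_bot : ∀ x, Φ x ≠ ⊥
  exists_ne_top : ∃ x, Φ x ≠ ⊤
  convex_epigraph : Convex ℝ {p : H × ℝ | Φ p.1 ≤ (p.2 : EReal)}
  lsc : LowerSemicontinuous Φ

/-- The set of global minimizers of `Φ`. -/
def argminSet (Φ : H → EReal) : Set H := {z | IsMinOn Φ univ z}

/-- The element of minimal norm of the set of global minimizers, i.e. the projection of `0`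
onto that set. -/
noncomputable def minNormMinimizer (Φ : H → EReal) : H :=
  argminOn (fun z : H => ‖z‖) (argminSet Φ)

/-- The objective `y ↦ Φ y + ‖x - y‖² / (2μ)`. -/
noncomputable def proxObjective (Φ : H → EReal) (μ : ℝ) (x y : H) : EReal :=
  Φ y + ((‖x - y‖ ^ 2 / (2 * μ) : ℝ) : EReal)

/-- The Moreau envelope of index `μ`; the infimum is finite for a proper function that is
bounded below. -/
noncomputable def moreau (Φ : H → EReal) (μ : ℝ) (x : H) : ℝ :=
  (⨅ y : H, proxObjective Φ μ x y).toReal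

/-- The proximal operator of parameter `μ`. -/
noncomputable def prox (Φ : H → EReal) (μ : ℝ) (x : H) : H :=
  argminOn (proxObjective Φ μ x) univ

/-- The regularized function `φ_{e,μ}(x) = Φ_μ(x) + e ‖x‖² / 2`. -/
noncomputable def regularized (Φ : H → EReal) (e μ : ℝ) (x : H) : ℝ :=
  moreau Φ μ x + e * ‖x‖ ^ 2 / 2

/-- The unique minimizer `x_{e,μ}` of the strongly convex function `φ_{e,μ}`. -/
noncomputable def regularizedMinimizer (Φ : H → EReal) (e μ : ℝ) : H :=
  argminOn (regularized Φ e μ) univ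

variable [CompleteSpace H]

/-- The velocity of a trajectory defined on `[t₀, ∞)`, one-sided at `t₀`. -/
noncomputable def velocity (t₀ : ℝ) (x : ℝ → H) (t : ℝ) : H := derivWithin x (Ici t₀) t

/-- `t ↦ ∇ Φ_{λ(t)} (x t)`. -/
noncomputable def envelopeGradient (Φ : H → EReal) (lam : ℝ → ℝ) (x : ℝ → H) (t : ℝ) : H :=
  gradient (moreau Φ (lam t)) (x t)

/-- `x` is a strong global solution on `[t₀, ∞)` of
`x'' + α √ε x' + β d/dt (∇ Φ_λ (x)) + ∇ Φ_λ (x) + ε x = 0`: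
it is differentiable, `x'` is locally absolutely continuous, and the equation holds at almost
every time, both derivatives in it existing. -/
structure IsStrongSolution (Φ : H → EReal) (lam eps : ℝ → ℝ) (α β t₀ : ℝ) (x : ℝ → H) :
    Prop where
  differentiableOn : DifferentiableOn ℝ x (Ici t₀)
  velocity_ac : ∀ T, t₀ ≤ T → AbsolutelyContinuousOnInterval (velocity t₀ x) t₀ T
  equation : ∀ᵐ t ∂(volume.restrict (Ioi t₀)), ∃ acc gradDot : H,
    HasDerivAt (velocity t₀ x) acc t ∧
    HasDerivAt (envelopeGradient Φ lam x) gradDot t ∧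
    acc + (α * √(eps t)) • velocity t₀ x t + β • gradDot
      + envelopeGradient Φ lam x t + eps t • x t = 0

/-- The energy function `E`. -/
noncomputable def energy (Φ : H → EReal) (lam eps : ℝ → ℝ) (β γ t₀ : ℝ) (x : ℝ → H) (t : ℝ) :
    ℝ :=
  regularized Φ (eps t) (lam t) (x t)
    - regularized Φ (eps t) (lam t) (regularizedMinimizer Φ (eps t) (lam t))
    + 1 / 2 * ‖(γ * √(eps t)) • (x t - regularizedMinimizer Φ (eps t) (lam t))
        + velocity t₀ x t + β • envelopeGradient Φ lam x t‖ ^ 2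

end Functionals

/-- The conditions on the parameter functions `λ`, `ε` and the constants under which the
Lyapunov analysis of `E` is carried out. -/
def ParameterConditions (lam eps : ℝ → ℝ) (α β γ a c : ℝ) : Prop :=
  Tendsto (fun t => lam t * eps t) atTop (𝓝 0) ∧
  ∀ᶠ t in atTop,
    deriv (fun s => 1 / √(eps s)) t
        ≤ min (2 * γ - α - γ * β * deriv eps t / (2 * eps t)) (α - γ * ((a + 1) / a)) ∧
    (2 * γ * (α - γ) + γ / c - 1) * eps t - β * deriv eps t ≤ 0 ∧
    2 * β * eps t ^ 2 + (2 - γ * β * √(eps t)) * deriv eps t ≤ 0 ∧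
    (γ / a + 2 * (α - γ)) * β ^ 2 * √(eps t) - 3 * β ^ 2 * deriv eps t / (2 * eps t)
        - deriv lam t ≤ β

/-- The smoothing parameter `λ(t) = t ^ l`. -/
noncomputable def polyLam (l : ℝ) (t : ℝ) : ℝ := t ^ l

/-- The Tikhonov parameter `ε(t) = 1 / t ^ d`. -/
noncomputable def polyEps (d : ℝ) (t : ℝ) : ℝ := 1 / t ^ d

end TikhonovFlow

/-! The whole analysis rests on the subgradient inequality at proximal points. Since `envGrad Φ μ x`
is a subgradient of `Φ` at `prox Φ μ x` for every index `μ`, comparing two proximal points with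
different indices gives a lower bound for the envelope jointly in point and index (`moreau_lower`).
Together with the upper bound obtained by testing the envelope with a frozen proximal point, it
yields the gradient, the derivative along curves with moving index, and all Lipschitz estimates.

Carrying out the minimization in `x` first shows that the minimum of `φ_{e,μ}` is the envelope of
index `μ + 1/e` at the origin, and that `x_{e,μ}` is `prox Φ (μ + 1/e) 0` divided by `1 + μ e`.
Hence the minimum value is differentiable in time. The minimizer itself need not be, but
monotonicity bounds its speed by a multiple of `‖x*‖ / t`, and `prox Φ s 0` converges to `x*` as `s`
grows.

Along a solution, with `s = √ε(t) = t ^ (-d/2)`, the derivative of the energy combines strong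
convexity of `φ`, viscous damping and the damping from the gradient derivative. Where `2γ(α - γ) ≤
1` and `t` is large, these absorb every cross term (`dissipation_le`), leaving `E' ≤ -(k/2) s E + C
s² / t` almost everywhere. As `d < 2`, a large multiple of `t ^ (-(d/2 + 1))` is a supersolution,
and a Gronwall comparison for absolutely continuous functions gives `energy_le`.

The energy dominates the gap of `φ`. This gap bounds the envelope gap up to `e ‖x*‖² / 2`, and by
strong convexity it bounds `‖x - x_{e,μ}‖²` (`rates_of_energy_le`). Strong convergence follows
because `x_{e,μ}` tends to `x*`. -/

namespace TikhonovFlow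

local notation "⟪" x "," y "⟫" => inner ℝ x y

/-! ### Proximal points, the Moreau envelope and its gradient -/

section Envelope

variable {H : Type*} [NormedAddCommGroup H] [InnerProductSpace ℝ H]

/-- A function bounded above by a real at a point where it is not `⊥` takes a real value there. -/
lemma exists_real_eq {c : EReal} {b : ℝ} (hbot : c ≠ ⊥) (hb : c ≤ b) : ∃ a : ℝ, c = a ∧ a ≤ b := by
  have htop : c ≠ ⊤ := fun h => by simp [h] at hb
  refine ⟨c.toReal, (EReal.coe_toReal htop hbot).symm, ?_⟩
  rw [← EReal.coe_toReal htop hbot] at hb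
  exact_mod_cast hb

lemma IsProperConvexLsc.isClosed_realEpigraph {Φ : H → EReal} (hΦ : IsProperConvexLsc Φ) :
    IsClosed {p : H × ℝ | Φ p.1 ≤ (p.2 : EReal)} := by
  have h := lowerSemicontinuous_iff_isClosed_epigraph.1 hΦ.lsc
  have hc : Continuous fun p : H × ℝ => (p.1, (p.2 : EReal)) :=
    continuous_fst.prodMk (continuous_coe_real_ereal.comp continuous_snd)
  exact h.preimage hc

lemma IsProperConvexLsc.exists_argmin_value {Φ : H → EReal} (hΦ : IsProperConvexLsc Φ) {z : H}
    (hz : z ∈ argminSet Φ) : ∃ m : ℝ, Φ z = m ∧ ∀ u, (m : EReal) ≤ Φ u := by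
  obtain ⟨w, hw⟩ := hΦ.exists_ne_top
  have hzu : ∀ u, Φ z ≤ Φ u := fun u => hz (mem_univ u)
  have htop : Φ z ≠ ⊤ := fun h => hw (top_le_iff.1 (h ▸ hzu w))
  have := EReal.coe_toReal htop (hΦ.ne_bot z)
  exact ⟨(Φ z).toReal, this.symm, fun u => this ▸ hzu u⟩

lemma norm_sub_midpoint_sq (x u v : H) :
    ‖x - (1 / 2 : ℝ) • (u + v)‖ ^ 2
      = (‖x - u‖ ^ 2 + ‖x - v‖ ^ 2) / 2 - ‖u - v‖ ^ 2 / 4 := by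
  have h := parallelogram_law_with_norm ℝ (x - u) (x - v)
  have h1 : x - (1 / 2 : ℝ) • (u + v) = (1 / 2 : ℝ) • ((x - u) + (x - v)) := by module
  have h2 : (x - u) - (x - v) = -(u - v) := by abel
  rw [h2, norm_neg] at h
  rw [h1, norm_smul, mul_pow]
  norm_num
  linarith

/-- Existence of the proximal point. -/
lemma IsProperConvexLsc.exists_prox [CompleteSpace H] {Φ : H → EReal} (hΦ : IsProperConvexLsc Φ)
    (hmin : (argminSet Φ).Nonempty) {μ : ℝ} (hμ : 0 < μ) (x : H) :
    ∃ (p : H) (a : ℝ), Φ p = a ∧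
      ∀ (u : H) (b : ℝ), Φ u ≤ b → a + ‖x - p‖ ^ 2 / (2 * μ) ≤ b + ‖x - u‖ ^ 2 / (2 * μ) := by
  obtain ⟨z, hz⟩ := hmin
  obtain ⟨m₀, hm₀, hm₀'⟩ := hΦ.exists_argmin_value hz
  -- Minimizing over the real epigraph turns the extended-valued problem into one for a real
  -- function, where convexity and closedness are directly available.
  set C : Set (H × ℝ) := {p | Φ p.1 ≤ (p.2 : EReal)} with hC
  set f : H × ℝ → ℝ := fun p => p.2 + ‖x - p.1‖ ^ 2 / (2 * μ) with hf
  have hbdd : BddBelow (f '' C) := by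
    refine ⟨m₀, ?_⟩
    rintro _ ⟨p, hp, rfl⟩
    have h1 : m₀ ≤ p.2 := by exact_mod_cast (hm₀' p.1).trans hp
    have h2 : 0 ≤ ‖x - p.1‖ ^ 2 / (2 * μ) := by positivity
    simp only [hf]; linarith
  have hne : (f '' C).Nonempty := ⟨_, (z, m₀), hm₀.le, rfl⟩
  set m := sInf (f '' C) with hm
  have hmle : ∀ p ∈ C, m ≤ f p := fun p hp => csInf_le hbdd ⟨p, hp, rfl⟩
  have hseq : ∀ n : ℕ, ∃ p ∈ C, f p < m + 1 / ((n : ℝ) + 1) := by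
    intro n
    obtain ⟨_, ⟨p, hp, rfl⟩, hlt⟩ :=
      exists_lt_of_csInf_lt hne (show m < m + 1 / ((n : ℝ) + 1) by
        linarith [Nat.one_div_pos_of_nat (α := ℝ) (n := n)])
    exact ⟨p, hp, hlt⟩
  choose P hPC hPlt using hseq
  -- The quadratic gains `‖·‖² / (8μ)` at a midpoint, so near-minimizers are close and the
  -- minimizing sequence is Cauchy.
  have hmid : ∀ i j N : ℕ, N ≤ i → N ≤ j →
      dist (P i).1 (P j).1 ≤ √(8 * μ * (1 / ((N : ℝ) + 1))) := by
    intro i j N hi hj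
    have hc : (1 / 2 : ℝ) • (P i + P j) ∈ C := by
      rw [smul_add]
      exact hΦ.convex_epigraph (hPC i) (hPC j) (by norm_num) (by norm_num) (by norm_num)
    have h1 := hmle _ hc
    have h2 : f ((1 / 2 : ℝ) • (P i + P j))
        = (f (P i) + f (P j)) / 2 - ‖(P i).1 - (P j).1‖ ^ 2 / (8 * μ) := by
      simp only [hf, Prod.smul_fst, Prod.fst_add, Prod.smul_snd, Prod.snd_add,
        norm_sub_midpoint_sq, smul_eq_mul]
      field_simp
      ring
    have hi' : f (P i) ≤ m + 1 / ((N : ℝ) + 1) :=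
      (hPlt i).le.trans (by gcongr)
    have hj' : f (P j) ≤ m + 1 / ((N : ℝ) + 1) :=
      (hPlt j).le.trans (by gcongr)
    have h3 : ‖(P i).1 - (P j).1‖ ^ 2 / (8 * μ) ≤ 1 / ((N : ℝ) + 1) := by linarith
    rw [dist_eq_norm]
    apply Real.le_sqrt_of_sq_le
    rwa [div_le_iff₀' (by positivity)] at h3
  have hlim1 : Tendsto (fun n : ℕ => 1 / ((n : ℝ) + 1)) atTop (𝓝 0) :=
    tendsto_one_div_add_atTop_nhds_zero_nat
  have hcau : CauchySeq fun n => (P n).1 := by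
    refine cauchySeq_of_le_tendsto_0 (fun N : ℕ => √(8 * μ * (1 / ((N : ℝ) + 1)))) hmid ?_
    simpa using (hlim1.const_mul (8 * μ)).sqrt
  obtain ⟨p, hp⟩ := cauchySeq_tendsto_of_complete hcau
  have hfm : Tendsto (fun n => f (P n)) atTop (𝓝 m) := by
    refine tendsto_of_tendsto_of_tendsto_of_le_of_le tendsto_const_nhds
      (by simpa using hlim1.const_add m) (fun n => hmle _ (hPC n)) (fun n => (hPlt n).le)
  have hsnd : Tendsto (fun n => (P n).2) atTop (𝓝 (m - ‖x - p‖ ^ 2 / (2 * μ))) := by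
    have h := hfm.sub ((((tendsto_const_nhds (x := x)).sub hp).norm.pow 2).div_const (2 * μ))
    simpa [hf] using h
  have hmem : (p, m - ‖x - p‖ ^ 2 / (2 * μ)) ∈ C :=
    hΦ.isClosed_realEpigraph.mem_of_tendsto (hp.prodMk_nhds hsnd) (Eventually.of_forall hPC)
  obtain ⟨a, ha, hale⟩ := exists_real_eq (hΦ.ne_bot p) hmem
  refine ⟨p, a, ha, fun u b hb => ?_⟩
  have := hmle (u, b) hb
  simp only [hf] at this
  linarith

lemma norm_sub_smul_sq (w v : H) (t : ℝ) :
    ‖w - t • v‖ ^ 2 = ‖w‖ ^ 2 - 2 * t * ⟪w, v⟫ + t ^ 2 * ‖v‖ ^ 2 := by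
  rw [norm_sub_sq_real, norm_smul, inner_smul_right, mul_pow, Real.norm_eq_abs, sq_abs]
  ring

/-- The optimality condition of the proximal point. -/
lemma IsProperConvexLsc.subgradient_of_isMin {Φ : H → EReal} (hΦ : IsProperConvexLsc Φ)
    {μ : ℝ} (hμ : 0 < μ) {x p : H} {a : ℝ} (ha : Φ p = a)
    (h : ∀ (u : H) (b : ℝ), Φ u ≤ b → a + ‖x - p‖ ^ 2 / (2 * μ) ≤ b + ‖x - u‖ ^ 2 / (2 * μ))
    (u : H) (b : ℝ) (hb : Φ u ≤ b) : a + ⟪(1 / μ) • (x - p), u - p⟫ ≤ b := by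
  set A := ‖u - p‖ ^ 2 / (2 * μ)
  -- Minimality is tested on the segment from `(p, a)` to `(u, b)`. Dividing by `t` leaves an error
  -- `t * A`, which vanishes as `t → 0`.
  have key : ∀ t : ℝ, 0 < t → t ≤ 1 → a + ⟪(1 / μ) • (x - p), u - p⟫ - b ≤ t * A := by
    intro t ht ht1
    have hc : ((1 - t) • (p, a) + t • (u, b) : H × ℝ) ∈ {p : H × ℝ | Φ p.1 ≤ (p.2 : EReal)} :=
      hΦ.convex_epigraph (x := (p, a)) (y := (u, b)) ha.le hb (by linarith) ht.le (by ring)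
    have h1 := h _ _ hc
    have h2 : x - ((1 - t) • (p, a) + t • (u, b) : H × ℝ).1 = (x - p) - t • (u - p) := by
      simp only [Prod.fst_add, Prod.smul_fst]; module
    rw [h2, norm_sub_smul_sq] at h1
    simp only [Prod.snd_add, Prod.smul_snd, smul_eq_mul] at h1
    rw [real_inner_smul_left]
    have h3 : t * (a + 1 / μ * ⟪x - p, u - p⟫ - b) ≤ t * (t * A) := by
      have e : (‖x - p‖ ^ 2 - 2 * t * ⟪x - p, u - p⟫ + t ^ 2 * ‖u - p‖ ^ 2) / (2 * μ)
          = ‖x - p‖ ^ 2 / (2 * μ) - t * (1 / μ * ⟪x - p, u - p⟫) + t * (t * A) := by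
        simp only [A]; field_simp
      rw [e] at h1
      nlinarith
    exact le_of_mul_le_mul_left h3 ht
  have hlim : Tendsto (fun t : ℝ => t * A) (𝓝[>] 0) (𝓝 0) := by
    have : Tendsto (fun t : ℝ => t * A) (𝓝 0) (𝓝 (0 * A)) := tendsto_id.mul_const A
    rw [zero_mul] at this
    exact this.mono_left nhdsWithin_le_nhds
  have := ge_of_tendsto hlim (b := a + ⟪(1 / μ) • (x - p), u - p⟫ - b) (by
    filter_upwards [Ioc_mem_nhdsGT (zero_lt_one' ℝ)] with t ht using key t ht.1 ht.2)
  linarith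

/-- A point satisfying the optimality condition is the proximal point. -/
lemma IsProperConvexLsc.prox_eq {Φ : H → EReal} (hΦ : IsProperConvexLsc Φ)
    {μ : ℝ} (hμ : 0 < μ) {x p : H} {a : ℝ} (ha : Φ p = a)
    (h : ∀ (u : H) (b : ℝ), Φ u ≤ b → a + ⟪(1 / μ) • (x - p), u - p⟫ ≤ b) :
    prox Φ μ x = p ∧ moreau Φ μ x = a + ‖x - p‖ ^ 2 / (2 * μ) := by
  have hval : proxObjective Φ μ x p = ((a + ‖x - p‖ ^ 2 / (2 * μ) : ℝ) : EReal) := by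
    rw [proxObjective, ha, EReal.coe_add]
  -- The quadratic gap gives minimality of `p` and also uniqueness, which identifies the point
  -- chosen by `Classical.epsilon`.
  have hstrong : ∀ (u : H) (b : ℝ), Φ u ≤ b →
      a + ‖x - p‖ ^ 2 / (2 * μ) + ‖u - p‖ ^ 2 / (2 * μ) ≤ b + ‖x - u‖ ^ 2 / (2 * μ) := by
    intro u b hb
    have h1 := h u b hb
    have h2 : x - u = (x - p) - (1 : ℝ) • (u - p) := by module
    rw [h2, norm_sub_smul_sq]
    rw [real_inner_smul_left] at h1
    have e : (‖x - p‖ ^ 2 - 2 * 1 * ⟪x - p, u - p⟫ + 1 ^ 2 * ‖u - p‖ ^ 2) / (2 * μ)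
        = ‖x - p‖ ^ 2 / (2 * μ) - (1 / μ * ⟪x - p, u - p⟫) + ‖u - p‖ ^ 2 / (2 * μ) := by
      field_simp
    rw [e]; linarith
  have hle : ∀ u, proxObjective Φ μ x p ≤ proxObjective Φ μ x u := by
    intro u
    by_cases hu : Φ u = ⊤
    · simp [proxObjective, hu]
    · have hu' := EReal.coe_toReal hu (hΦ.ne_bot u)
      have := hstrong u _ hu'.ge
      rw [hval, proxObjective, ← hu', ← EReal.coe_add, EReal.coe_le_coe_iff]
      have h3 : 0 ≤ ‖u - p‖ ^ 2 / (2 * μ) := by positivity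
      linarith
  constructor
  · have hex : ∃ y, y ∈ univ ∧ IsMinOn (proxObjective Φ μ x) univ y :=
      ⟨p, mem_univ _, fun u _ => hle u⟩
    obtain ⟨-, hs⟩ := Classical.epsilon_spec hex
    set y := Classical.epsilon fun y => y ∈ univ ∧ IsMinOn (proxObjective Φ μ x) univ y with hy
    have h1 : proxObjective Φ μ x y ≤ proxObjective Φ μ x p := hs (mem_univ p)
    change y = p
    rw [hval] at h1
    have hyt : Φ y ≠ ⊤ := fun ht => by
      rw [proxObjective, ht, EReal.top_add_coe, top_le_iff] at h1
      exact EReal.coe_ne_top _ h1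
    have hy' := EReal.coe_toReal hyt (hΦ.ne_bot y)
    have h2 := hstrong y _ hy'.ge
    rw [proxObjective, ← hy', ← EReal.coe_add, EReal.coe_le_coe_iff] at h1
    have h3 : ‖y - p‖ ^ 2 / (2 * μ) ≤ 0 := by linarith
    have h4 : ‖y - p‖ ^ 2 ≤ 0 := by
      rwa [div_le_iff₀ (by positivity), zero_mul] at h3
    have h5 : ‖y - p‖ = 0 := by nlinarith [norm_nonneg (y - p)]
    exact sub_eq_zero.1 (norm_eq_zero.1 h5)
  · rw [moreau, le_antisymm (iInf_le _ p) (le_iInf hle), hval, EReal.toReal_coe]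

/-- The gradient of the Moreau envelope. -/
noncomputable def envGrad (Φ : H → EReal) (μ : ℝ) (x : H) : H := (1 / μ) • (x - prox Φ μ x)

/-- The value of `Φ` at the proximal point. -/
noncomputable def proxValue (Φ : H → EReal) (μ : ℝ) (x : H) : ℝ := (Φ (prox Φ μ x)).toReal

variable {Φ : H → EReal}

lemma prox_eq_sub {μ : ℝ} (hμ : 0 < μ) (x : H) : prox Φ μ x = x - μ • envGrad Φ μ x := by
  rw [envGrad, smul_smul, mul_one_div_cancel hμ.ne', one_smul, sub_sub_cancel]

lemma sub_prox {μ : ℝ} (hμ : 0 < μ) (x : H) : x - prox Φ μ x = μ • envGrad Φ μ x := by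
  rw [prox_eq_sub hμ, sub_sub_cancel]

lemma norm_sub_prox_sq {μ : ℝ} (hμ : 0 < μ) (x : H) :
    ‖x - prox Φ μ x‖ ^ 2 = μ ^ 2 * ‖envGrad Φ μ x‖ ^ 2 := by
  rw [sub_prox hμ, norm_smul, mul_pow, Real.norm_eq_abs, sq_abs]

lemma IsProperConvexLsc.prox_argmin (hΦ : IsProperConvexLsc Φ) {z : H} (hz : z ∈ argminSet Φ)
    {μ : ℝ} (hμ : 0 < μ) :
    prox Φ μ z = z ∧ envGrad Φ μ z = 0 ∧ moreau Φ μ z = (⨅ y, Φ y).toReal := by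
  obtain ⟨m, hm, hm'⟩ := hΦ.exists_argmin_value hz
  obtain ⟨h1, h2⟩ := hΦ.prox_eq hμ (x := z) (p := z) hm (fun u b hb => by
    simpa using (by exact_mod_cast (hm' u).trans hb : m ≤ b))
  refine ⟨h1, by simp [envGrad, h1], ?_⟩
  have : (⨅ y, Φ y) = m := le_antisymm (hm ▸ iInf_le _ z) (le_iInf hm')
  rw [h2, this]; simp

variable [CompleteSpace H]

lemma IsProperConvexLsc.prox_spec (hΦ : IsProperConvexLsc Φ)
    (hmin : (argminSet Φ).Nonempty) {μ : ℝ} (hμ : 0 < μ) (x : H) :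
    Φ (prox Φ μ x) = proxValue Φ μ x ∧
    (∀ (u : H) (b : ℝ), Φ u ≤ b → proxValue Φ μ x + ⟪envGrad Φ μ x, u - prox Φ μ x⟫ ≤ b) ∧
    moreau Φ μ x = proxValue Φ μ x + ‖x - prox Φ μ x‖ ^ 2 / (2 * μ) := by
  obtain ⟨p, a, ha, h⟩ := hΦ.exists_prox hmin hμ x
  have hsub := hΦ.subgradient_of_isMin hμ ha h
  obtain ⟨hp, hm⟩ := hΦ.prox_eq hμ ha hsub
  have hv : proxValue Φ μ x = a := by rw [proxValue, hp, ha, EReal.toReal_coe]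
  rw [hv, envGrad, hp]
  exact ⟨ha, hsub, hm⟩

lemma IsProperConvexLsc.moreau_eq (hΦ : IsProperConvexLsc Φ)
    (hmin : (argminSet Φ).Nonempty) {μ : ℝ} (hμ : 0 < μ) (x : H) :
    moreau Φ μ x = proxValue Φ μ x + μ / 2 * ‖envGrad Φ μ x‖ ^ 2 := by
  rw [(hΦ.prox_spec hmin hμ x).2.2, norm_sub_prox_sq hμ]
  field_simp

/-- Joint convexity of the envelope in the point and the index, in quantitative form. -/
lemma IsProperConvexLsc.moreau_lower (hΦ : IsProperConvexLsc Φ)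
    (hmin : (argminSet Φ).Nonempty) {ν μ : ℝ} (hν : 0 < ν) (hμ : 0 < μ) (x x' : H) :
    moreau Φ ν x + ⟪envGrad Φ ν x, x' - x⟫ + (ν - μ) / 2 * ‖envGrad Φ ν x‖ ^ 2
      + μ / 2 * ‖envGrad Φ μ x' - envGrad Φ ν x‖ ^ 2 ≤ moreau Φ μ x' := by
  -- The subgradient at one proximal point is tested at the other, which belongs to a different
  -- index; the rest is completing the square.
  have h := (hΦ.prox_spec hmin hν x).2.1 _ _ (hΦ.prox_spec hmin hμ x').1.le
  rw [hΦ.moreau_eq hmin hν, hΦ.moreau_eq hmin hμ, norm_sub_sq_real]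
  have e : prox Φ μ x' - prox Φ ν x
      = (x' - x) + ν • envGrad Φ ν x - μ • envGrad Φ μ x' := by
    rw [prox_eq_sub hμ, prox_eq_sub hν]; abel
  rw [e, inner_sub_right, inner_add_right, inner_smul_right, inner_smul_right,
    real_inner_self_eq_norm_sq] at h
  rw [real_inner_comm (envGrad Φ ν x) (envGrad Φ μ x')]
  linarith

lemma IsProperConvexLsc.moreau_le (hΦ : IsProperConvexLsc Φ)
    (hmin : (argminSet Φ).Nonempty) {μ : ℝ} (hμ : 0 < μ) {u : H} {b : ℝ} (hb : Φ u ≤ b) (x : H) :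
    moreau Φ μ x ≤ b + ‖x - u‖ ^ 2 / (2 * μ) := by
  obtain ⟨h1, h2, h3⟩ := hΦ.prox_spec hmin hμ x
  have h := h2 u b hb
  have e : x - u = (x - prox Φ μ x) - (1 : ℝ) • (u - prox Φ μ x) := by module
  rw [h3, e, norm_sub_smul_sq]
  rw [envGrad, real_inner_smul_left] at h
  have e : (‖x - prox Φ μ x‖ ^ 2 - 2 * 1 * ⟪x - prox Φ μ x, u - prox Φ μ x⟫
      + 1 ^ 2 * ‖u - prox Φ μ x‖ ^ 2) / (2 * μ)
        = ‖x - prox Φ μ x‖ ^ 2 / (2 * μ) - (1 / μ * ⟪x - prox Φ μ x, u - prox Φ μ x⟫)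
          + ‖u - prox Φ μ x‖ ^ 2 / (2 * μ) := by
      field_simp
  rw [e]
  have : 0 ≤ ‖u - prox Φ μ x‖ ^ 2 / (2 * μ) := by positivity
  linarith

/-- Monotonicity of the subdifferential: `envGrad` is a subgradient at the proximal point whatever
the index, so the indices may differ. -/
lemma IsProperConvexLsc.inner_envGrad_sub_prox_nonneg (hΦ : IsProperConvexLsc Φ)
    (hmin : (argminSet Φ).Nonempty) {ν μ : ℝ} (hν : 0 < ν) (hμ : 0 < μ) (x x' : H) :
    0 ≤ ⟪envGrad Φ ν x - envGrad Φ μ x', prox Φ ν x - prox Φ μ x'⟫ := by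
  have h1 := (hΦ.prox_spec hmin hν x).2.1 _ _ (hΦ.prox_spec hmin hμ x').1.le
  have h2 := (hΦ.prox_spec hmin hμ x').2.1 _ _ (hΦ.prox_spec hmin hν x).1.le
  rw [inner_sub_left]
  have : ⟪envGrad Φ ν x, prox Φ ν x - prox Φ μ x'⟫
      = - ⟪envGrad Φ ν x, prox Φ μ x' - prox Φ ν x⟫ := by
    rw [← inner_neg_right, neg_sub]
  linarith

/-- Writing each proximal point as `x - μ • envGrad Φ μ x` turns monotonicity into a bound on the
difference of gradients; the change of index appears as a perturbation of the point. -/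
lemma IsProperConvexLsc.envGrad_lipschitz (hΦ : IsProperConvexLsc Φ)
    (hmin : (argminSet Φ).Nonempty) {ν μ : ℝ} (hν : 0 < ν) (hμ : 0 < μ) (x x' : H) :
    ν * ‖envGrad Φ ν x - envGrad Φ μ x'‖ ≤ ‖x - x'‖ + |μ - ν| * ‖envGrad Φ μ x'‖ := by
  have h3 := hΦ.inner_envGrad_sub_prox_nonneg hmin hν hμ x x'
  set q := envGrad Φ ν x
  set q' := envGrad Φ μ x'
  have e : prox Φ ν x - prox Φ μ x' = ((x - x') + (μ - ν) • q') - ν • (q - q') := by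
    rw [prox_eq_sub hμ, prox_eq_sub hν]; module
  rw [e, inner_sub_right, inner_smul_right, real_inner_self_eq_norm_sq] at h3
  have h4 := real_inner_le_norm (q - q') ((x - x') + (μ - ν) • q')
  have h5 : ‖(x - x') + (μ - ν) • q'‖ ≤ ‖x - x'‖ + |μ - ν| * ‖q'‖ := by
    refine (norm_add_le _ _).trans ?_
    rw [norm_smul, Real.norm_eq_abs]
  rcases (norm_nonneg (q - q')).eq_or_lt with h0 | h0
  · rw [← h0, mul_zero]; positivity
  · refine le_of_mul_le_mul_left ?_ h0
    nlinarith [mul_le_mul_of_nonneg_left h5 h0.le]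

lemma IsProperConvexLsc.norm_envGrad_le (hΦ : IsProperConvexLsc Φ) {z : H}
    (hz : z ∈ argminSet Φ) {μ : ℝ} (hμ : 0 < μ) (x : H) :
    μ * ‖envGrad Φ μ x‖ ≤ ‖x - z‖ := by
  simpa [(hΦ.prox_argmin hz hμ).2.1] using hΦ.envGrad_lipschitz ⟨z, hz⟩ hμ hμ x z

/-- Cocoercivity against a minimizer, where the gradient vanishes: the quantitative convexity bounds
in both directions are added. -/
lemma IsProperConvexLsc.inner_envGrad_ge (hΦ : IsProperConvexLsc Φ) {z : H}
    (hz : z ∈ argminSet Φ) {μ : ℝ} (hμ : 0 < μ) (x : H) :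
    μ * ‖envGrad Φ μ x‖ ^ 2 ≤ ⟪envGrad Φ μ x, x - z⟫ := by
  have h1 := hΦ.moreau_lower ⟨z, hz⟩ hμ hμ x z
  have h2 := hΦ.moreau_lower ⟨z, hz⟩ hμ hμ z x
  obtain ⟨-, h3, -⟩ := hΦ.prox_argmin hz hμ
  rw [h3] at h1 h2
  simp only [inner_zero_left, sub_self, zero_div, zero_mul, add_zero, sub_zero, zero_sub,
    norm_neg] at h1 h2
  have : ⟪envGrad Φ μ x, z - x⟫ = - ⟪envGrad Φ μ x, x - z⟫ := by
    rw [← inner_neg_right, neg_sub]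
  linarith

/-- The envelope lies above its tangent by convexity and below tangent plus `‖x' - x‖² / (2μ)`, by
testing the infimum at `x'` with the proximal point of `x`. -/
lemma IsProperConvexLsc.hasGradientAt_moreau (hΦ : IsProperConvexLsc Φ)
    (hmin : (argminSet Φ).Nonempty) {μ : ℝ} (hμ : 0 < μ) (x : H) :
    HasGradientAt (moreau Φ μ) (envGrad Φ μ x) x := by
  rw [hasGradientAt_iff_isLittleO]
  have hO : (fun x' => moreau Φ μ x' - moreau Φ μ x - ⟪envGrad Φ μ x, x' - x⟫)
      =O[𝓝 x] fun x' => ‖x' - x‖ ^ 2 := by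
    refine Asymptotics.IsBigO.of_bound (1 / (2 * μ)) (Eventually.of_forall fun x' => ?_)
    have h1 := hΦ.moreau_lower hmin hμ hμ x x'
    have h2 := hΦ.moreau_le hmin hμ (hΦ.prox_spec hmin hμ x).1.le x'
    have h3 := hΦ.moreau_eq hmin hμ x
    have e : x' - prox Φ μ x = μ • envGrad Φ μ x - (-1 : ℝ) • (x' - x) := by
      rw [prox_eq_sub hμ]; module
    rw [e, norm_sub_smul_sq, real_inner_smul_left, norm_smul, mul_pow, Real.norm_eq_abs,
      sq_abs] at h2
    have e2 : (μ ^ 2 * ‖envGrad Φ μ x‖ ^ 2 - 2 * -1 * (μ * ⟪envGrad Φ μ x, x' - x⟫)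
        + (-1) ^ 2 * ‖x' - x‖ ^ 2) / (2 * μ) = μ / 2 * ‖envGrad Φ μ x‖ ^ 2
          + ⟪envGrad Φ μ x, x' - x⟫ + 1 / (2 * μ) * ‖x' - x‖ ^ 2 := by
      field_simp; ring
    have h4 : 0 ≤ μ / 2 * ‖envGrad Φ μ x' - envGrad Φ μ x‖ ^ 2 := by positivity
    have h5 : 0 ≤ 1 / (2 * μ) * ‖x' - x‖ ^ 2 := by positivity
    rw [sub_self, zero_div, zero_mul] at h1
    rw [Real.norm_eq_abs, norm_pow, norm_norm, abs_le]
    constructor <;> linarith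
  refine hO.trans_isLittleO ?_
  have := Asymptotics.isLittleO_norm_pow_id (E' := H) (n := 2) (by norm_num)
  have ht : Tendsto (fun x' : H => x' - x) (𝓝 x) (𝓝 0) := by
    simpa using (tendsto_id (x := 𝓝 x)).sub_const x
  exact this.comp_tendsto ht

lemma IsProperConvexLsc.gradient_moreau (hΦ : IsProperConvexLsc Φ)
    (hmin : (argminSet Φ).Nonempty) {μ : ℝ} (hμ : 0 < μ) (x : H) :
    gradient (moreau Φ μ) x = envGrad Φ μ x :=
  (hΦ.hasGradientAt_moreau hmin hμ x).gradient

end Envelope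

/-! ### Minimizer of least norm and minimizers of the regularized functions -/

section Minimizers

variable {H : Type*} [NormedAddCommGroup H] [InnerProductSpace ℝ H] {Φ : H → EReal}

lemma IsProperConvexLsc.convex_argminSet (hΦ : IsProperConvexLsc Φ) :
    Convex ℝ (argminSet Φ) := by
  intro u hu v hv a b ha hb hab w _
  obtain ⟨m, hm, hm'⟩ := hΦ.exists_argmin_value hu
  have hvm : Φ v ≤ m := hm ▸ hv (mem_univ u)
  have h := hΦ.convex_epigraph (x := (u, m)) (y := (v, m)) hm.le hvm ha hb hab
  have e : a • m + b • m = m := by rw [← add_smul, hab, one_smul]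
  have h' : Φ (a • u + b • v) ≤ ((a • m + b • m : ℝ) : EReal) := h
  rw [e] at h'
  exact h'.trans (hm' w)

lemma IsProperConvexLsc.isClosed_argminSet (hΦ : IsProperConvexLsc Φ) :
    IsClosed (argminSet Φ) := by
  have h : argminSet Φ = ⋂ w, Φ ⁻¹' Iic (Φ w) := by
    ext z; simp [argminSet, IsMinOn, IsMinFilter]
  rw [h]
  exact isClosed_iInter fun w => hΦ.lsc.isClosed_preimage _

lemma envGrad_zero (s : ℝ) : envGrad Φ s 0 = (-(1 / s)) • prox Φ s 0 := by
  rw [envGrad, zero_sub, smul_neg, neg_smul]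

variable [CompleteSpace H]

lemma IsProperConvexLsc.minNormMinimizer_spec (hΦ : IsProperConvexLsc Φ)
    (hmin : (argminSet Φ).Nonempty) :
    minNormMinimizer Φ ∈ argminSet Φ ∧ ∀ z ∈ argminSet Φ, ‖minNormMinimizer Φ‖ ≤ ‖z‖ := by
  obtain ⟨v, hv, hv'⟩ := exists_norm_eq_iInf_of_complete_convex hmin
    hΦ.isClosed_argminSet.isComplete hΦ.convex_argminSet 0
  have hex : ∃ y, y ∈ argminSet Φ ∧ IsMinOn (fun z : H => ‖z‖) (argminSet Φ) y := by
    refine ⟨v, hv, fun w hw => ?_⟩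
    have hb : BddBelow (range fun w : argminSet Φ => ‖(0 : H) - w‖) :=
      ⟨0, by rintro _ ⟨w, rfl⟩; exact norm_nonneg _⟩
    have := ciInf_le hb ⟨w, hw⟩
    rw [← hv'] at this
    simpa using this
  exact Classical.epsilon_spec hex

lemma IsProperConvexLsc.eq_minNormMinimizer (hΦ : IsProperConvexLsc Φ) {z : H}
    (hz : z ∈ argminSet Φ) (hn : ‖z‖ ≤ ‖minNormMinimizer Φ‖) : z = minNormMinimizer Φ := by
  obtain ⟨h1, h2⟩ := hΦ.minNormMinimizer_spec ⟨z, hz⟩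
  set w := minNormMinimizer Φ
  have hm : (1 / 2 : ℝ) • (z + w) ∈ argminSet Φ := by
    rw [smul_add]
    exact hΦ.convex_argminSet hz h1 (by norm_num) (by norm_num) (by norm_num)
  have h3 := h2 _ hm
  have h4 := norm_sub_midpoint_sq 0 z w
  simp only [zero_sub, norm_neg] at h4
  have h5 : ‖z - w‖ ^ 2 ≤ 0 := by
    nlinarith [norm_nonneg z, norm_nonneg w, norm_nonneg ((1 / 2 : ℝ) • (z + w))]
  have h6 : ‖z - w‖ = 0 := by nlinarith [norm_nonneg (z - w)]
  exact sub_eq_zero.1 (norm_eq_zero.1 h6)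

lemma IsProperConvexLsc.norm_prox_zero_le (hΦ : IsProperConvexLsc Φ)
    (hmin : (argminSet Φ).Nonempty) {s : ℝ} (hs : 0 < s) :
    ‖prox Φ s 0‖ ≤ ‖minNormMinimizer Φ‖ := by
  have h := hΦ.inner_envGrad_ge (hΦ.minNormMinimizer_spec hmin).1 hs 0
  set w := minNormMinimizer Φ
  set z := prox Φ s 0 with hz
  rw [envGrad_zero, zero_sub, inner_neg_right, real_inner_smul_left, norm_smul, mul_pow,
    Real.norm_eq_abs, sq_abs, ← hz] at h
  have e : s * ((-(1 / s)) ^ 2 * ‖z‖ ^ 2) = (1 / s) * ‖z‖ ^ 2 := by field_simp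
  rw [e, neg_mul, neg_neg] at h
  have h1 : ‖z‖ ^ 2 ≤ ⟪z, w⟫ := le_of_mul_le_mul_left h (by positivity)
  have h2 := real_inner_le_norm z w
  by_contra! hlt
  nlinarith [norm_nonneg w]

/-- Monotonicity for the subgradients `-z / r` and `-z' / s` at the proximal points of the origin,
with denominators cleared. The next two estimates are rearrangements of it. -/
lemma IsProperConvexLsc.inner_prox_zero_nonneg (hΦ : IsProperConvexLsc Φ)
    (hmin : (argminSet Φ).Nonempty) {r s : ℝ} (hr : 0 < r) (hs : 0 < s) :
    r * ‖prox Φ s 0‖ ^ 2 + s * ‖prox Φ r 0‖ ^ 2 ≤ (r + s) * ⟪prox Φ r 0, prox Φ s 0⟫ := by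
  have h := hΦ.inner_envGrad_sub_prox_nonneg hmin hr hs 0 0
  rw [envGrad_zero, envGrad_zero] at h
  set z := prox Φ r 0
  set z' := prox Φ s 0
  rw [inner_sub_left, inner_sub_right, inner_sub_right, real_inner_smul_left,
    real_inner_smul_left, real_inner_smul_left, real_inner_smul_left,
    real_inner_self_eq_norm_sq, real_inner_self_eq_norm_sq, real_inner_comm z z'] at h
  have h' := mul_nonneg (mul_pos hr hs).le h
  have e : r * s * (-(1 / r) * ‖z‖ ^ 2 - -(1 / r) * ⟪z, z'⟫
      - (-(1 / s) * ⟪z, z'⟫ - -(1 / s) * ‖z'‖ ^ 2))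
      = (r + s) * ⟪z, z'⟫ - (r * ‖z'‖ ^ 2 + s * ‖z‖ ^ 2) := by
    field_simp; ring
  linarith

/-- The curve `s ↦ prox Φ s 0` is Lipschitz relative to `s`. This replaces a derivative of the curve
of regularized minimizers. -/
lemma IsProperConvexLsc.norm_prox_zero_sub_le (hΦ : IsProperConvexLsc Φ)
    (hmin : (argminSet Φ).Nonempty) {r s : ℝ} (hr : 0 < r) (hs : 0 < s) :
    ‖prox Φ r 0 - prox Φ s 0‖ ≤ |r - s| / s * ‖minNormMinimizer Φ‖ := by
  have h := hΦ.inner_prox_zero_nonneg hmin hr hs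
  have hN := hΦ.norm_prox_zero_le hmin hs
  set z := prox Φ r 0
  set z' := prox Φ s 0
  have h1 : s * ‖z - z'‖ ^ 2 ≤ (r - s) * ⟪z', z - z'⟫ := by
    rw [norm_sub_sq_real, inner_sub_right, real_inner_self_eq_norm_sq, real_inner_comm z z']
    nlinarith
  have h2 : (r - s) * ⟪z', z - z'⟫ ≤ |r - s| * (‖z'‖ * ‖z - z'‖) := by
    refine (le_abs_self _).trans ?_
    rw [abs_mul]
    exact mul_le_mul_of_nonneg_left (abs_real_inner_le_norm _ _) (abs_nonneg _)
  rw [div_mul_eq_mul_div, le_div_iff₀ hs]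
  rcases (norm_nonneg (z - z')).eq_or_lt with h0 | h0
  · rw [← h0, zero_mul]; positivity
  · refine le_of_mul_le_mul_left ?_ h0
    have h3 := mul_le_mul_of_nonneg_left hN (mul_nonneg (abs_nonneg (r - s)) h0.le)
    nlinarith

/-- Distances are controlled by increments of the squared norm, so monotone boundedness of the norm
makes the curve Cauchy. -/
lemma IsProperConvexLsc.norm_prox_zero_sub_sq_le (hΦ : IsProperConvexLsc Φ)
    (hmin : (argminSet Φ).Nonempty) {r s : ℝ} (hr : 0 < r) (hrs : r ≤ s) :
    ‖prox Φ r 0 - prox Φ s 0‖ ^ 2 ≤ ‖prox Φ s 0‖ ^ 2 - ‖prox Φ r 0‖ ^ 2 := by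
  have h := hΦ.inner_prox_zero_nonneg hmin hr (hr.trans_le hrs)
  set z := prox Φ r 0
  set z' := prox Φ s 0
  have h1 := norm_sub_sq_real z z'
  have h2 : (r + s) * ‖z - z'‖ ^ 2 ≤ (s - r) * (‖z'‖ ^ 2 - ‖z‖ ^ 2) := by nlinarith
  have h3 : 0 ≤ ‖z'‖ ^ 2 - ‖z‖ ^ 2 := by
    rcases hrs.eq_or_lt with h0 | h0
    · subst h0; simp [z, z']
    · refine nonneg_of_mul_nonneg_right ?_ (sub_pos.2 h0)
      have hs := hr.trans_le hrs
      have : 0 ≤ (r + s) * ‖z - z'‖ ^ 2 := by positivity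
      exact this.trans h2
  refine le_of_mul_le_mul_left (h2.trans ?_) (show 0 < r + s by linarith)
  exact mul_le_mul_of_nonneg_right (by linarith) h3

/-- The proximal points of the origin converge to the minimizer of least norm. -/
lemma IsProperConvexLsc.tendsto_prox_zero (hΦ : IsProperConvexLsc Φ)
    (hmin : (argminSet Φ).Nonempty) :
    Tendsto (fun s => prox Φ s 0) atTop (𝓝 (minNormMinimizer Φ)) := by
  set w := minNormMinimizer Φ
  obtain ⟨hw, -⟩ := hΦ.minNormMinimizer_spec hmin
  -- Truncating the index at 1 keeps it positive, so the curve is monotone in norm on all of `ℝ`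
  -- without changing its limit.
  set Z : ℝ → H := fun s => prox Φ (max s 1) 0 with hZ
  have hpos : ∀ s : ℝ, 0 < max s 1 := fun s => lt_max_of_lt_right one_pos
  have hsq : ∀ r s : ℝ, r ≤ s → ‖Z r - Z s‖ ^ 2 ≤ ‖Z s‖ ^ 2 - ‖Z r‖ ^ 2 := fun r s hrs =>
    hΦ.norm_prox_zero_sub_sq_le hmin (hpos r) (max_le_max_right 1 hrs)
  have hmono : Monotone fun s => ‖Z s‖ ^ 2 := fun r s hrs => by
    have := hsq r s hrs
    have h0 := sq_nonneg ‖Z r - Z s‖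
    simp only; linarith
  have hbd : BddAbove (range fun s => ‖Z s‖ ^ 2) := by
    refine ⟨‖w‖ ^ 2, ?_⟩
    rintro _ ⟨s, rfl⟩
    have := hΦ.norm_prox_zero_le hmin (hpos s)
    simp only; gcongr
  have hG := tendsto_atTop_ciSup hmono hbd
  set G := ⨆ s, ‖Z s‖ ^ 2
  have hdist : ∀ r s : ℝ, r ≤ s → dist (Z r) (Z s) ≤ √(G - ‖Z r‖ ^ 2) := fun r s hrs => by
    rw [dist_eq_norm]
    apply Real.le_sqrt_of_sq_le
    have := le_ciSup hbd s
    linarith [hsq r s hrs]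
  have hcau : CauchySeq Z := by
    refine cauchySeq_of_le_tendsto_0 (fun N => 2 * √(G - ‖Z N‖ ^ 2)) (fun n m N hn hm => ?_) ?_
    · have := dist_triangle_left (Z n) (Z m) (Z N)
      linarith [hdist N n hn, hdist N m hm]
    · simpa using ((hG.const_sub G).sqrt).const_mul 2
  obtain ⟨p, hp⟩ := cauchySeq_tendsto_of_complete hcau
  have hlim : Tendsto (fun s => prox Φ s 0) atTop (𝓝 p) := by
    refine hp.congr' ?_
    filter_upwards [eventually_ge_atTop 1] with s hs
    simp [hZ, hs]
  obtain ⟨m, hm, hm'⟩ := hΦ.exists_argmin_value hw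
  have hval : ∀ᶠ s : ℝ in atTop,
      ((prox Φ s 0, m + ‖w‖ ^ 2 / (2 * s)) : H × ℝ) ∈ {p : H × ℝ | Φ p.1 ≤ (p.2 : EReal)} := by
    filter_upwards [eventually_gt_atTop 0] with s hs
    have h1 := hΦ.moreau_le hmin hs hm.le 0
    have h2 := hΦ.moreau_eq hmin hs 0
    have h3 : 0 ≤ s / 2 * ‖envGrad Φ s 0‖ ^ 2 := by positivity
    rw [zero_sub, norm_neg] at h1
    change Φ (prox Φ s 0) ≤ ((m + ‖w‖ ^ 2 / (2 * s) : ℝ) : EReal)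
    rw [(hΦ.prox_spec hmin hs 0).1, EReal.coe_le_coe_iff]
    linarith
  have hr : Tendsto (fun s : ℝ => m + ‖w‖ ^ 2 / (2 * s)) atTop (𝓝 m) := by
    have : Tendsto (fun s : ℝ => ‖w‖ ^ 2 / (2 * s)) atTop (𝓝 0) :=
      tendsto_const_nhds.div_atTop (tendsto_id.const_mul_atTop two_pos)
    simpa using this.const_add m
  have hpm : Φ p ≤ m := hΦ.isClosed_realEpigraph.mem_of_tendsto (hlim.prodMk_nhds hr) hval
  have hpa : p ∈ argminSet Φ := fun u _ => hpm.trans (hm' u)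
  have hpn : ‖p‖ ≤ ‖w‖ := by
    refine le_of_tendsto hlim.norm ?_
    filter_upwards [eventually_gt_atTop 0] with s hs using hΦ.norm_prox_zero_le hmin hs
  rwa [show p = w from hΦ.eq_minNormMinimizer hpa hpn] at hlim

/-- The minimizer of the regularized function in terms of a proximal point of the origin. -/
lemma IsProperConvexLsc.regularizedMinimizer_spec (hΦ : IsProperConvexLsc Φ)
    (hmin : (argminSet Φ).Nonempty) {e μ : ℝ} (he : 0 < e) (hμ : 0 < μ) :
    regularizedMinimizer Φ e μ = (1 / (1 + μ * e)) • prox Φ (μ + 1 / e) 0 ∧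
    envGrad Φ μ (regularizedMinimizer Φ e μ) = (-e) • regularizedMinimizer Φ e μ ∧
    regularized Φ e μ (regularizedMinimizer Φ e μ) = moreau Φ (μ + 1 / e) 0 ∧
    ∀ x, regularized Φ e μ (regularizedMinimizer Φ e μ)
      + e / 2 * ‖x - regularizedMinimizer Φ e μ‖ ^ 2
      + μ / 2 * ‖envGrad Φ μ x + e • regularizedMinimizer Φ e μ‖ ^ 2 ≤ regularized Φ e μ x := by
  have hs : 0 < μ + 1 / e := by positivity
  have h1 : 0 < 1 + μ * e := by positivity
  obtain ⟨ha, hb, hc⟩ := hΦ.prox_spec hmin hs 0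
  have hq : envGrad Φ (μ + 1 / e) 0 = (-(1 / (μ + 1 / e))) • prox Φ (μ + 1 / e) 0 := by
    rw [envGrad, zero_sub, smul_neg, neg_smul]
  set z := prox Φ (μ + 1 / e) 0 with hz
  set y : H := (1 / (1 + μ * e)) • z with hy
  -- The scaling of `y` is chosen so that `(y - z) / μ` equals the subgradient at `z` coming from
  -- index `μ + 1/e` at the origin; hence `z` is also the proximal point of `y` with index `μ`.
  have hqz : (1 / μ) • (y - z) = envGrad Φ (μ + 1 / e) 0 := by
    rw [hq, hy]
    have : (1 / (1 + μ * e)) • z - z = (1 / (1 + μ * e) - 1) • z := by module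
    rw [this, smul_smul]
    congr 1
    field_simp
    ring
  obtain ⟨hp, hm⟩ := hΦ.prox_eq hμ (x := y) (p := z) ha (by rw [hqz]; exact hb)
  have hgy : envGrad Φ μ y = (-e) • y := by
    rw [envGrad, hp, hqz, hq, hy, smul_smul]
    congr 1
    field_simp
    ring
  have hval : regularized Φ e μ y = moreau Φ (μ + 1 / e) 0 := by
    have e2 : z = (1 + μ * e) • y := by
      rw [hy, smul_smul, mul_one_div_cancel h1.ne', one_smul]
    have e1 : y - z = (-(μ * e)) • y := by rw [e2]; module
    have e3 : ‖z‖ ^ 2 = (1 + μ * e) ^ 2 * ‖y‖ ^ 2 := by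
      rw [e2, norm_smul, mul_pow, Real.norm_eq_abs, sq_abs]
    rw [regularized, hm, hc, e1, zero_sub, norm_neg, norm_smul, mul_pow, Real.norm_eq_abs,
      sq_abs, e3]
    generalize proxValue Φ (μ + 1 / e) 0 = b
    field_simp
    ring
  have hle : ∀ x, regularized Φ e μ y + e / 2 * ‖x - y‖ ^ 2
      + μ / 2 * ‖envGrad Φ μ x + e • y‖ ^ 2 ≤ regularized Φ e μ x := by
    intro x
    have h := hΦ.moreau_lower hmin hμ hμ y x
    rw [hgy, neg_smul, sub_neg_eq_add, inner_neg_left, real_inner_smul_left, sub_self, zero_div,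
      zero_mul, inner_sub_right, real_inner_self_eq_norm_sq] at h
    rw [regularized, regularized, norm_sub_sq_real, real_inner_comm]
    linarith
  have hmin_eq : regularizedMinimizer Φ e μ = y := by
    have hex : ∃ u, u ∈ univ ∧ IsMinOn (regularized Φ e μ) univ u := by
      refine ⟨y, mem_univ _, fun u _ => ?_⟩
      have h2 : 0 ≤ e / 2 * ‖u - y‖ ^ 2 := by positivity
      have h3 : 0 ≤ μ / 2 * ‖envGrad Φ μ u + e • y‖ ^ 2 := by positivity
      have := hle u
      change regularized Φ e μ y ≤ regularized Φ e μ u; linarith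
    have h4 : regularized Φ e μ (regularizedMinimizer Φ e μ) ≤ regularized Φ e μ y :=
      (Classical.epsilon_spec hex).2 (mem_univ y)
    have h5 := hle (regularizedMinimizer Φ e μ)
    have h6 : 0 ≤ μ / 2 * ‖envGrad Φ μ (regularizedMinimizer Φ e μ) + e • y‖ ^ 2 := by positivity
    have h7 : e / 2 * ‖regularizedMinimizer Φ e μ - y‖ ^ 2 ≤ 0 := by linarith
    have h8 : ‖regularizedMinimizer Φ e μ - y‖ ^ 2 = 0 :=
      le_antisymm (by nlinarith [sq_nonneg ‖regularizedMinimizer Φ e μ - y‖]) (sq_nonneg _)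
    exact sub_eq_zero.1 (norm_eq_zero.1 (pow_eq_zero_iff two_ne_zero |>.1 h8))
  rw [hmin_eq]
  exact ⟨rfl, hgy, hval, hle⟩

lemma IsProperConvexLsc.regularized_lower (hΦ : IsProperConvexLsc Φ)
    (hmin : (argminSet Φ).Nonempty) {e μ : ℝ} (hμ : 0 < μ) (x y : H) :
    regularized Φ e μ x + ⟪envGrad Φ μ x + e • x, y - x⟫ + e / 2 * ‖y - x‖ ^ 2
      ≤ regularized Φ e μ y := by
  have h := hΦ.moreau_lower hmin hμ hμ x y
  have h3 : 0 ≤ μ / 2 * ‖envGrad Φ μ y - envGrad Φ μ x‖ ^ 2 := by positivity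
  rw [sub_self, zero_div, zero_mul] at h
  rw [regularized, regularized, inner_add_left, real_inner_smul_left, norm_sub_sq_real,
    real_inner_comm x y, inner_sub_right x, real_inner_self_eq_norm_sq]
  linarith

/-- The value bound comes from comparison with `x*`, at which the envelope equals `min Φ`. -/
lemma IsProperConvexLsc.regularizedMinimizer_le (hΦ : IsProperConvexLsc Φ)
    (hmin : (argminSet Φ).Nonempty) {e μ : ℝ} (he : 0 < e) (hμ : 0 < μ) :
    ‖regularizedMinimizer Φ e μ‖ ≤ ‖minNormMinimizer Φ‖ ∧
    regularized Φ e μ (regularizedMinimizer Φ e μ)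
      ≤ (⨅ y, Φ y).toReal + e * ‖minNormMinimizer Φ‖ ^ 2 / 2 := by
  obtain ⟨h1, -, -, h4⟩ := hΦ.regularizedMinimizer_spec hmin he hμ
  constructor
  · rw [h1, norm_smul, Real.norm_of_nonneg (by positivity)]
    refine le_trans ?_ (hΦ.norm_prox_zero_le hmin (s := μ + 1 / e) (by positivity))
    refine mul_le_of_le_one_left (norm_nonneg _) ?_
    rw [div_le_one (by positivity)]
    nlinarith [mul_pos hμ he]
  · have h := h4 (minNormMinimizer Φ)
    have e0 : regularized Φ e μ (minNormMinimizer Φ)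
        = (⨅ y, Φ y).toReal + e * ‖minNormMinimizer Φ‖ ^ 2 / 2 := by
      rw [regularized, (hΦ.prox_argmin (hΦ.minNormMinimizer_spec hmin).1 hμ).2.2]
    rw [e0] at h
    have : 0 ≤ e / 2 * ‖minNormMinimizer Φ - regularizedMinimizer Φ e μ‖ ^ 2 := by positivity
    have : 0 ≤ μ / 2 * ‖envGrad Φ μ (minNormMinimizer Φ) + e • regularizedMinimizer Φ e μ‖ ^ 2 := by
      positivity
    linarith

end Minimizers

/-! ### Derivative comparison and Gronwall for absolutely continuous functions -/

section RealCalculus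

lemma hasDerivAt_of_squeeze {f g h : ℝ → ℝ} {d a : ℝ} (hg : HasDerivAt g d a)
    (hh : HasDerivAt h d a) (hga : g a = f a) (hha : h a = f a)
    (hgf : ∀ᶠ s in 𝓝 a, g s ≤ f s) (hfh : ∀ᶠ s in 𝓝 a, f s ≤ h s) : HasDerivAt f d a := by
  rw [hasDerivAt_iff_isLittleO] at *
  refine Asymptotics.IsBigO.trans_isLittleO (g := fun s =>
    ‖g s - g a - (s - a) • d‖ + ‖h s - h a - (s - a) • d‖) ?_ (hg.norm_left.add hh.norm_left)
  refine Asymptotics.IsBigO.of_bound 1 ?_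
  filter_upwards [hgf, hfh] with s h1 h2
  rw [hga, hha, one_mul,
    Real.norm_of_nonneg (add_nonneg (norm_nonneg _) (norm_nonneg _)), Real.norm_eq_abs,
    Real.norm_eq_abs, Real.norm_eq_abs, abs_le]
  constructor
  · have := neg_abs_le (g s - f a - (s - a) • d)
    have := abs_nonneg (h s - f a - (s - a) • d)
    linarith
  · have := le_abs_self (h s - f a - (s - a) • d)
    have := abs_nonneg (g s - f a - (s - a) • d)
    linarith

/-- Lets the energy be compared with a differentiable majorant touching it at `t`, the
non-differentiable part entering only through a Lipschitz-type error. Points to the right of `t`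
suffice. -/
lemma hasDerivAt_le_add {f g K : ℝ → ℝ} {f' g' k t : ℝ} (hf : HasDerivAt f f' t)
    (hg : HasDerivAt g g' t) (heq : f t = g t)
    (hle : ∀ᶠ s in 𝓝[>] t, f s ≤ g s + K s * (s - t)) (hK : Tendsto K (𝓝[>] t) (𝓝 k)) :
    f' ≤ g' + k := by
  have h1 := (hasDerivWithinAt_iff_tendsto_slope' (notMem_Ioi.2 le_rfl)).1
    (hf.hasDerivWithinAt (s := Ioi t))
  have h2 := (hasDerivWithinAt_iff_tendsto_slope' (notMem_Ioi.2 le_rfl)).1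
    (hg.hasDerivWithinAt (s := Ioi t))
  refine le_of_tendsto_of_tendsto h1 (h2.add hK) ?_
  filter_upwards [hle, self_mem_nhdsWithin] with s hs hst
  have hpos : 0 < s - t := sub_pos.2 hst
  rw [slope_def_field, slope_def_field, div_add' _ _ _ hpos.ne']
  gcongr
  linarith

/-- The fundamental theorem of calculus for absolutely continuous functions. The derivative
condition may be vacuous on a null set only, since such functions are differentiable almost
everywhere. -/
lemma le_of_ae_deriv_nonpos {f : ℝ → ℝ} {a b : ℝ} (hab : a ≤ b)
    (hf : AbsolutelyContinuousOnInterval f a b)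
    (h : ∀ᵐ t, t ∈ Ioo a b → ∀ f', HasDerivAt f f' t → f' ≤ 0) : f b ≤ f a := by
  have hint := hf.integral_deriv_eq_sub
  have hle : ∫ t in a..b, deriv f t ≤ ∫ _ in a..b, (0 : ℝ) := by
    refine intervalIntegral.integral_mono_ae_restrict hab hf.intervalIntegrable_deriv
      intervalIntegrable_const ?_
    rw [Measure.restrict_congr_set Ioo_ae_eq_Icc.symm]
    refine (ae_restrict_iff' measurableSet_Ioo).2 ?_
    filter_upwards [h, hf.ae_differentiableAt] with t ht hd hm
    exact ht hm _ (hd (uIcc_of_le hab ▸ Ioo_subset_Icc_self hm)).hasDerivAt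
  rw [hint, intervalIntegral.integral_zero] at hle
  linarith

/-- A Gronwall comparison principle for absolutely continuous functions. -/
lemma le_of_ae_deriv_le {E h h' R ρ : ℝ → ℝ} {a b : ℝ} (hab : a ≤ b)
    (hE : AbsolutelyContinuousOnInterval E a b) (hh : AbsolutelyContinuousOnInterval h a b)
    (hR : AbsolutelyContinuousOnInterval (fun t => Real.exp (R t)) a b)
    (hhd : ∀ t ∈ Ioo a b, HasDerivAt h (h' t) t) (hRd : ∀ t ∈ Ioo a b, HasDerivAt R (ρ t) t)
    (hle : ∀ᵐ t, t ∈ Ioo a b → ∀ E', HasDerivAt E E' t → E' - h' t ≤ -ρ t * (E t - h t))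
    (ha : E a ≤ h a) : E b ≤ h b := by
  have hac : AbsolutelyContinuousOnInterval (fun t => Real.exp (R t) * (E t - h t)) a b :=
    hR.fun_mul (hE.fun_sub hh)
  have hEd := hE.ae_differentiableAt
  have key := le_of_ae_deriv_nonpos hab hac (by
    filter_upwards [hle, hEd] with t ht hd hm f' hf'
    have hE' := (hd (uIcc_of_le hab ▸ Ioo_subset_Icc_self hm)).hasDerivAt
    have h1 := ((hRd t hm).exp).mul (hE'.sub (hhd t hm))
    have h2 := ht hm _ hE'
    rw [hf'.unique h1]
    have h3 := mul_le_mul_of_nonneg_left h2 (Real.exp_pos (R t)).le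
    simp only [Pi.sub_apply]
    linarith)
  have h1 : Real.exp (R a) * (E a - h a) ≤ 0 :=
    mul_nonpos_of_nonneg_of_nonpos (Real.exp_pos _).le (by linarith)
  have h2 : Real.exp (R b) * (E b - h b) ≤ 0 := by simpa using key.trans h1
  have := nonpos_of_mul_nonpos_right h2 (Real.exp_pos _)
  linarith

lemma absolutelyContinuousOnInterval_norm {F : Type*} [SeminormedAddCommGroup F] {f : ℝ → F}
    {a b : ℝ} (hf : AbsolutelyContinuousOnInterval f a b) :
    AbsolutelyContinuousOnInterval (fun t => ‖f t‖) a b := by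
  refine squeeze_zero (fun t ↦ ?_) (fun t ↦ ?_) hf
  · exact Finset.sum_nonneg (fun i _ ↦ dist_nonneg)
  · exact Finset.sum_le_sum fun i _ =>
      (dist_norm_norm_le _ _).trans_eq (dist_eq_norm _ _).symm

end RealCalculus

/-! ### Lipschitz functions on a compact interval -/

section LipschitzOnInterval

variable {F : Type*} [NormedAddCommGroup F]

/-- `f` is Lipschitz on the interval `[a, b]`. -/
def LipOn (f : ℝ → F) (a b : ℝ) : Prop :=
  ∃ K, 0 ≤ K ∧ ∀ s ∈ Icc a b, ∀ t ∈ Icc a b, ‖f s - f t‖ ≤ K * |s - t|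

variable {f g : ℝ → F} {a b : ℝ}

lemma LipOn.congr (hf : LipOn f a b) (h : ∀ t ∈ Icc a b, g t = f t) : LipOn g a b := by
  obtain ⟨K, hK, hf⟩ := hf
  exact ⟨K, hK, fun s hs t ht => by rw [h s hs, h t ht]; exact hf s hs t ht⟩

lemma LipOn.bounded (hf : LipOn f a b) : ∃ M, 0 ≤ M ∧ ∀ t ∈ Icc a b, ‖f t‖ ≤ M := by
  obtain ⟨K, hK, hf⟩ := hf
  refine ⟨‖f a‖ + K * |b - a|, by positivity, fun t ht => ?_⟩
  have ha : a ∈ Icc a b := ⟨le_rfl, ht.1.trans ht.2⟩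
  have h1 := hf t ht a ha
  have h2 : |t - a| ≤ |b - a| := by
    rw [abs_of_nonneg (by linarith [ht.1]), abs_of_nonneg (by linarith [ha.2])]
    linarith [ht.2]
  have h3 := norm_le_norm_add_norm_sub' (f t) (f a)
  nlinarith [mul_le_mul_of_nonneg_left h2 hK]

lemma LipOn.of_le {E : Type*} [NormedAddCommGroup E] {f : ℝ → F} {g : ℝ → E} {h : ℝ → ℝ}
    (hg : LipOn g a b) (hh : LipOn h a b) {A B : ℝ} (hA : 0 ≤ A) (hB : 0 ≤ B)
    (hle : ∀ s ∈ Icc a b, ∀ t ∈ Icc a b, ‖f s - f t‖ ≤ A * ‖g s - g t‖ + B * |h s - h t|) :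
    LipOn f a b := by
  obtain ⟨K, hK, hg⟩ := hg
  obtain ⟨L, hL, hh⟩ := hh
  refine ⟨A * K + B * L, by positivity, fun s hs t ht => (hle s hs t ht).trans ?_⟩
  have h1 := mul_le_mul_of_nonneg_left (hg s hs t ht) hA
  have h2 := mul_le_mul_of_nonneg_left (hh s hs t ht) hB
  rw [Real.norm_eq_abs] at h2
  linarith

lemma LipOn.const (c : F) : LipOn (fun _ => c) a b := ⟨0, le_rfl, by simp⟩

lemma LipOn.add (hf : LipOn f a b) (hg : LipOn g a b) : LipOn (fun t => f t + g t) a b := by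
  obtain ⟨K, hK, hf⟩ := hf
  obtain ⟨L, hL, hg⟩ := hg
  refine ⟨K + L, by positivity, fun s hs t ht => ?_⟩
  rw [add_sub_add_comm, add_mul]
  exact (norm_add_le _ _).trans (add_le_add (hf s hs t ht) (hg s hs t ht))

lemma LipOn.sub (hf : LipOn f a b) (hg : LipOn g a b) : LipOn (fun t => f t - g t) a b := by
  obtain ⟨K, hK, hf⟩ := hf
  obtain ⟨L, hL, hg⟩ := hg
  refine ⟨K + L, by positivity, fun s hs t ht => ?_⟩
  rw [sub_sub_sub_comm, add_mul]
  exact (norm_sub_le _ _).trans (add_le_add (hf s hs t ht) (hg s hs t ht))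

lemma LipOn.smul [NormedSpace ℝ F] {c : ℝ → ℝ} (hc : LipOn c a b) (hf : LipOn f a b) :
    LipOn (fun t => c t • f t) a b := by
  obtain ⟨M, hM, hcM⟩ := hc.bounded
  obtain ⟨N, hN, hfN⟩ := hf.bounded
  refine LipOn.of_le hf hc hM hN fun s hs t ht => ?_
  have e : c s • f s - c t • f t = c s • (f s - f t) + (c s - c t) • f t := by module
  rw [e]
  refine (norm_add_le _ _).trans ?_
  rw [norm_smul, norm_smul, mul_comm N]
  exact add_le_add (mul_le_mul_of_nonneg_right (hcM s hs) (norm_nonneg _))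
    (mul_le_mul_of_nonneg_left (hfN t ht) (abs_nonneg _))

lemma LipOn.norm (hf : LipOn f a b) : LipOn (fun t => ‖f t‖) a b := by
  obtain ⟨K, hK, hf⟩ := hf
  exact ⟨K, hK, fun s hs t ht => (abs_norm_sub_norm_le _ _).trans (hf s hs t ht)⟩

lemma LipOn.of_hasDerivAt [NormedSpace ℝ F] {f' : ℝ → F}
    (hf : ∀ t ∈ Icc a b, HasDerivAt f (f' t) t) (hc : ContinuousOn f' (Icc a b)) :
    LipOn f a b := by
  obtain ⟨C, hC⟩ := isCompact_Icc.exists_bound_of_continuousOn hc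
  refine ⟨max C 0, le_max_right _ _, fun s hs t ht => ?_⟩
  exact Convex.norm_image_sub_le_of_norm_hasDerivWithin_le
    (fun u hu => (hf u hu).hasDerivWithinAt) (fun u hu => (hC u hu).trans (le_max_left _ _))
    (convex_Icc a b) ht hs

lemma LipOn.absolutelyContinuous (hf : LipOn f a b) (hab : a ≤ b) :
    AbsolutelyContinuousOnInterval f a b := by
  obtain ⟨K, hK, hf⟩ := hf
  refine LipschitzOnWith.absolutelyContinuousOnInterval (K := ⟨K, hK⟩) ?_
  rw [uIcc_of_le hab]
  refine LipschitzOnWith.of_dist_le_mul fun s hs t ht => ?_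
  rw [dist_eq_norm, Real.dist_eq]
  exact hf s hs t ht

end LipschitzOnInterval

/-! ### The envelope along curves with moving index -/

section Curves

variable {H : Type*} [NormedAddCommGroup H] [InnerProductSpace ℝ H] [CompleteSpace H]
  {Φ : H → EReal}

/-- The envelope is differentiable along a curve with moving index. -/
lemma IsProperConvexLsc.hasDerivAt_moreau (hΦ : IsProperConvexLsc Φ)
    (hmin : (argminSet Φ).Nonempty) {lam : ℝ → ℝ} {x : ℝ → H} {l' t : ℝ} {x' : H}
    (hlam : HasDerivAt lam l' t) (hx : HasDerivAt x x' t) (hpos : 0 < lam t) :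
    HasDerivAt (fun s => moreau Φ (lam s) (x s))
      (⟪envGrad Φ (lam t) (x t), x'⟫ - l' / 2 * ‖envGrad Φ (lam t) (x t)‖ ^ 2) t := by
  set q := envGrad Φ (lam t) (x t) with hq
  set p := prox Φ (lam t) (x t) with hp
  have hev : ∀ᶠ s in 𝓝 t, 0 < lam s := hlam.continuousAt.eventually (lt_mem_nhds hpos)
  have hxp : x t - p = lam t • q := sub_prox hpos _
  have hnorm : ‖x t - p‖ ^ 2 = lam t ^ 2 * ‖q‖ ^ 2 := norm_sub_prox_sq hpos _
  -- The lower function freezes the gradient `q` in the joint convexity bound, the upper one freezes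
  -- the proximal point `p` in the infimum. They touch the envelope at `t` with equal derivatives.
  refine hasDerivAt_of_squeeze
    (g := fun s => moreau Φ (lam t) (x t) + ⟪q, x s - x t⟫ + (lam t - lam s) / 2 * ‖q‖ ^ 2)
    (h := fun s => proxValue Φ (lam t) (x t) + ‖x s - p‖ ^ 2 / (2 * lam s)) ?_ ?_ ?_ ?_ ?_ ?_
  · have h1 : HasDerivAt (fun s => ⟪q, x s - x t⟫) ⟪q, x'⟫ t := by
      simpa using (hasDerivAt_const t q).inner ℝ (hx.sub_const (x t))
    have h2 := ((hlam.const_sub (lam t)).div_const 2).mul_const (‖q‖ ^ 2)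
    refine ((h1.const_add (moreau Φ (lam t) (x t))).add h2).congr_deriv ?_
    ring
  · have h1 := (hx.sub_const p).norm_sq
    have h2 := (h1.div (hlam.const_mul 2) (by positivity)).const_add (proxValue Φ (lam t) (x t))
    refine h2.congr_deriv ?_
    rw [hxp, norm_smul, mul_pow, Real.norm_eq_abs, sq_abs, real_inner_smul_left]
    field_simp
  · simp
  · rw [hΦ.moreau_eq hmin hpos, hnorm, ← hq]
    field_simp
  · filter_upwards [hev] with s hs
    have h := hΦ.moreau_lower hmin hpos hs (x t) (x s)
    have : 0 ≤ lam s / 2 * ‖envGrad Φ (lam s) (x s) - envGrad Φ (lam t) (x t)‖ ^ 2 := by positivity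
    linarith
  · filter_upwards [hev] with s hs
    exact hΦ.moreau_le hmin hs (hΦ.prox_spec hmin hpos (x t)).1.le (x s)

/-- An index at least 1 lets the factor on the left of `envGrad_lipschitz` and `norm_envGrad_le` be
dropped, giving constants uniform on the interval. -/
lemma IsProperConvexLsc.lipOn_envGrad (hΦ : IsProperConvexLsc Φ)
    (hmin : (argminSet Φ).Nonempty) {lam : ℝ → ℝ} {x : ℝ → H} {a b : ℝ}
    (hx : LipOn x a b) (hlam : LipOn lam a b) (h1 : ∀ t ∈ Icc a b, 1 ≤ lam t) :
    LipOn (fun t => envGrad Φ (lam t) (x t)) a b := by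
  obtain ⟨w, hw⟩ := hmin
  obtain ⟨M, hM, hxM⟩ := (hx.sub (LipOn.const w)).bounded
  refine LipOn.of_le hx hlam (A := 1) (B := M) zero_le_one hM fun s hs t ht => ?_
  have hs0 : 0 < lam s := one_pos.trans_le (h1 s hs)
  have ht0 : 0 < lam t := one_pos.trans_le (h1 t ht)
  have h := hΦ.envGrad_lipschitz ⟨w, hw⟩ hs0 ht0 (x s) (x t)
  have h2 : ‖envGrad Φ (lam t) (x t)‖ ≤ M :=
    (le_mul_of_one_le_left (norm_nonneg _) (h1 t ht)).trans
      ((hΦ.norm_envGrad_le hw ht0 (x t)).trans (hxM t ht))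
  have h3 := le_mul_of_one_le_left (norm_nonneg (envGrad Φ (lam s) (x s)
    - envGrad Φ (lam t) (x t))) (h1 s hs)
  rw [abs_sub_comm] at h
  have h4 := mul_le_mul_of_nonneg_left h2 (abs_nonneg (lam s - lam t))
  linarith

lemma IsProperConvexLsc.lipOn_moreau (hΦ : IsProperConvexLsc Φ)
    (hmin : (argminSet Φ).Nonempty) {lam : ℝ → ℝ} {x : ℝ → H} {a b : ℝ}
    (hx : LipOn x a b) (hlam : LipOn lam a b) (h1 : ∀ t ∈ Icc a b, 1 ≤ lam t) :
    LipOn (fun t => moreau Φ (lam t) (x t)) a b := by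
  obtain ⟨M, hM, hqM⟩ := (hΦ.lipOn_envGrad hmin hx hlam h1).bounded
  refine LipOn.of_le hx hlam (A := M) (B := M ^ 2) hM (by positivity) ?_
  have key : ∀ s ∈ Icc a b, ∀ t ∈ Icc a b, moreau Φ (lam s) (x s) - moreau Φ (lam t) (x t)
      ≤ M * ‖x s - x t‖ + M ^ 2 * |lam s - lam t| := by
    intro s hs t ht
    have hs0 : 0 < lam s := one_pos.trans_le (h1 s hs)
    have ht0 : 0 < lam t := one_pos.trans_le (h1 t ht)
    have h := hΦ.moreau_lower hmin hs0 ht0 (x s) (x t)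
    have hq := hqM s hs
    set q := envGrad Φ (lam s) (x s)
    have h2 : 0 ≤ lam t / 2 * ‖envGrad Φ (lam t) (x t) - q‖ ^ 2 := by positivity
    have h3 : -⟪q, x t - x s⟫ ≤ M * ‖x s - x t‖ := by
      rw [← inner_neg_right, neg_sub]
      exact (real_inner_le_norm _ _).trans (mul_le_mul_of_nonneg_right hq (norm_nonneg _))
    have h4 : -((lam s - lam t) / 2 * ‖q‖ ^ 2) ≤ M ^ 2 * |lam s - lam t| := by
      have h5 : ‖q‖ ^ 2 ≤ M ^ 2 := by gcongr
      have h6 := neg_abs_le (lam s - lam t)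
      have h7 := abs_nonneg (lam s - lam t)
      nlinarith [mul_le_mul_of_nonneg_right h5 h7, mul_nonneg (sq_nonneg ‖q‖) h7]
    linarith
  intro s hs t ht
  rw [Real.norm_eq_abs, abs_sub_le_iff]
  refine ⟨key s hs t ht, ?_⟩
  rw [norm_sub_rev, abs_sub_comm]
  exact key t ht s hs

end Curves

/-! ### Derivative of the energy -/

section EnergyDerivative

variable {H : Type*} [NormedAddCommGroup H] [InnerProductSpace ℝ H] [CompleteSpace H]
  {Φ : H → EReal}

lemma IsProperConvexLsc.regularizedMinimizer_sub_le (hΦ : IsProperConvexLsc Φ)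
    (hmin : (argminSet Φ).Nonempty) {e μ e' μ' : ℝ} (he : 0 < e) (hμ : 0 < μ) (he' : 0 < e')
    (hμ' : 0 < μ') :
    ‖regularizedMinimizer Φ e μ - regularizedMinimizer Φ e' μ'‖
      ≤ (|1 / (1 + μ * e) - 1 / (1 + μ' * e')|
        + |μ + 1 / e - (μ' + 1 / e')| / (μ' + 1 / e')) * ‖minNormMinimizer Φ‖ := by
  have hs : 0 < μ + 1 / e := by positivity
  have hs' : 0 < μ' + 1 / e' := by positivity
  rw [(hΦ.regularizedMinimizer_spec hmin he hμ).1, (hΦ.regularizedMinimizer_spec hmin he' hμ').1]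
  have h1 := hΦ.norm_prox_zero_sub_le hmin hs hs'
  have h2 := hΦ.norm_prox_zero_le hmin hs
  have h3 : 0 ≤ 1 / (1 + μ' * e') := by positivity
  have h4 : 1 / (1 + μ' * e') ≤ 1 := by
    rw [div_le_one (by positivity)]; nlinarith [mul_pos hμ' he']
  set z := prox Φ (μ + 1 / e) 0
  set z' := prox Φ (μ' + 1 / e') 0
  set r := 1 / (1 + μ * e)
  set r' := 1 / (1 + μ' * e')
  have e1 : r • z - r' • z' = (r - r') • z + r' • (z - z') := by module
  rw [e1, add_mul]
  refine (norm_add_le _ _).trans (add_le_add ?_ ?_)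
  · rw [norm_smul, Real.norm_eq_abs]
    exact mul_le_mul_of_nonneg_left h2 (abs_nonneg _)
  · rw [norm_smul, Real.norm_of_nonneg h3]
    exact (mul_le_of_le_one_left (norm_nonneg _) h4).trans h1

lemma IsProperConvexLsc.envGrad_index_zero (hΦ : IsProperConvexLsc Φ)
    (hmin : (argminSet Φ).Nonempty) {e μ : ℝ} (he : 0 < e) (hμ : 0 < μ) :
    envGrad Φ (μ + 1 / e) 0 = (-e) • regularizedMinimizer Φ e μ := by
  rw [(hΦ.regularizedMinimizer_spec hmin he hμ).1, envGrad_zero, smul_smul]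
  congr 1
  field_simp
  ring

/-- An upper bound of the derivative of the energy.  The curve of regularized minimizers need not
be differentiable, so its velocity enters only through a bound on its speed. -/
lemma IsProperConvexLsc.energy_deriv_le (hΦ : IsProperConvexLsc Φ)
    (hmin : (argminSet Φ).Nonempty) {lam eps : ℝ → ℝ} {β γ t₀ t l' e' E' : ℝ} {x : ℝ → H}
    {w acc gd : H} (hγ : 0 ≤ γ) (hlam : HasDerivAt lam l' t) (heps : HasDerivAt eps e' t)
    (hlam0 : 0 < lam t) (heps0 : 0 < eps t) (hw : w = velocity t₀ x t)
    (hx : HasDerivAt x w t) (hv : HasDerivAt (velocity t₀ x) acc t)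
    (hg : HasDerivAt (envelopeGradient Φ lam x) gd t)
    (hE : HasDerivAt (energy Φ lam eps β γ t₀ x) E' t) :
    E' ≤ ⟪envGrad Φ (lam t) (x t) + eps t • x t, w⟫
        - l' / 2 * ‖envGrad Φ (lam t) (x t)‖ ^ 2 + e' / 2 * ‖x t‖ ^ 2
        + (l' * eps t ^ 2 - e') / 2 * ‖regularizedMinimizer Φ (eps t) (lam t)‖ ^ 2
        + ⟪(γ * √(eps t)) • (x t - regularizedMinimizer Φ (eps t) (lam t)) + w
            + β • envGrad Φ (lam t) (x t),
          (γ * (e' / (2 * √(eps t)))) • (x t - regularizedMinimizer Φ (eps t) (lam t))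
            + (γ * √(eps t)) • w + (acc + β • gd)⟫
        + γ * √(eps t) * ‖(γ * √(eps t)) • (x t - regularizedMinimizer Φ (eps t) (lam t)) + w
            + β • envGrad Φ (lam t) (x t)‖
          * ((|l' * eps t + lam t * e'| + |l' - e' / eps t ^ 2| / (lam t + 1 / eps t))
            * ‖minNormMinimizer Φ‖) := by
  set N := ‖minNormMinimizer Φ‖
  set y : ℝ → H := fun s => regularizedMinimizer Φ (eps s) (lam s) with hy
  set c : ℝ → ℝ := fun s => γ * √(eps s) with hc
  set ρ : ℝ → ℝ := fun s => 1 / (1 + lam s * eps s) with hρ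
  set σ : ℝ → ℝ := fun s => lam s + 1 / eps s with hσ
  set V : ℝ → H := fun s => c s • (x s - y s) + velocity t₀ x s + β • envelopeGradient Φ lam x s
    with hV
  -- `U` is `V` with the regularized minimizer frozen at time `t`, hence differentiable; `U - V` is
  -- controlled by the displacement of the minimizer.
  set U : ℝ → H := fun s => c s • (x s - y t) + velocity t₀ x s + β • envelopeGradient Φ lam x s
    with hU
  have hev : ∀ᶠ s in 𝓝 t, 0 < lam s ∧ 0 < eps s :=
    (hlam.continuousAt.eventually (lt_mem_nhds hlam0)).and
      (heps.continuousAt.eventually (lt_mem_nhds heps0))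
  have hp0 : 0 < 1 + lam t * eps t := by positivity
  have hρd : HasDerivAt ρ (-(l' * eps t + lam t * e') / (1 + lam t * eps t) ^ 2) t := by
    have h := ((hlam.mul heps).const_add 1).inv hp0.ne'
    simp only [hρ, one_div]
    exact h
  have hσd : HasDerivAt σ (l' - e' / eps t ^ 2) t := by
    have h := hlam.add (heps.inv heps0.ne')
    simp only [hσ, one_div]
    refine h.congr_deriv ?_
    ring
  have hσ0 : 0 < σ t := by simp only [hσ]; positivity
  have hcd : HasDerivAt c (γ * (e' / (2 * √(eps t)))) t := (heps.sqrt heps0.ne').const_mul γ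
  have hydist : ∀ᶠ s in 𝓝 t, ‖y s - y t‖ ≤ (|ρ s - ρ t| + |σ s - σ t| / σ t) * N := by
    filter_upwards [hev] with s hs
    exact hΦ.regularizedMinimizer_sub_le hmin hs.2 hs.1 heps0 hlam0
  have hyc : ContinuousAt y t := by
    rw [ContinuousAt, tendsto_iff_norm_sub_tendsto_zero]
    refine squeeze_zero' (Eventually.of_forall fun _ => norm_nonneg _) hydist ?_
    have h1 : ContinuousAt (fun s => (|ρ s - ρ t| + |σ s - σ t| / σ t) * N) t := by
      have := hρd.continuousAt
      have := hσd.continuousAt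
      fun_prop
    simpa [ContinuousAt] using h1
  have hVc : ContinuousAt V t := by
    have := hx.continuousAt
    have := hv.continuousAt
    have := hg.continuousAt
    have := hcd.continuousAt
    fun_prop
  have hgt : envelopeGradient Φ lam x t = envGrad Φ (lam t) (x t) :=
    hΦ.gradient_moreau hmin hlam0 (x t)
  set q := envGrad Φ (lam t) (x t) with hq
  have hVt : V t = c t • (x t - y t) + w + β • q := by simp only [hV, hgt, hw]
  have hUd : HasDerivAt U ((γ * (e' / (2 * √(eps t)))) • (x t - y t) + c t • w + (acc + β • gd))
      t := by
    have h := ((hcd.smul (hx.sub_const (y t))).add hv).add (hg.const_smul β)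
    refine h.congr_deriv ?_
    abel
  have hMd := hΦ.hasDerivAt_moreau hmin hlam hx hlam0
  -- The minimum value is the envelope of index `σ` at the fixed point 0, so only the index moves
  -- and no derivative of the minimizer is needed.
  have hSd := hΦ.hasDerivAt_moreau hmin (x := fun _ => (0 : H)) hσd (hasDerivAt_const t 0) hσ0
  have hNd := (heps.mul hx.norm_sq).div_const 2
  have hGd := ((hMd.add hNd).sub hSd).add (hUd.norm_sq.const_mul (1 / 2))
  have hyq : envGrad Φ (σ t) 0 = (-eps t) • y t := hΦ.envGrad_index_zero hmin heps0 hlam0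
  have hEeq : ∀ s, 0 < lam s ∧ 0 < eps s → energy Φ lam eps β γ t₀ x s
      = moreau Φ (lam s) (x s) + eps s * ‖x s‖ ^ 2 / 2 - moreau Φ (σ s) 0
        + 1 / 2 * ‖V s‖ ^ 2 := fun s hs => by
    rw [energy, (hΦ.regularizedMinimizer_spec hmin hs.2 hs.1).2.2.1, regularized]
  have hUV : U t = V t := rfl
  have main := hasDerivAt_le_add (t := t) (k := c t * ‖V t‖ * (N *
      (|(-(l' * eps t + lam t * e') / (1 + lam t * eps t) ^ 2)| + |l' - e' / eps t ^ 2| / σ t)))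
    (K := fun s => c s * ‖V s‖ * (N * (|slope ρ t s| + |slope σ t s| / σ t))) hE hGd ?_ ?_ ?_
  · have hk : |(-(l' * eps t + lam t * e') / (1 + lam t * eps t) ^ 2)|
        ≤ |l' * eps t + lam t * e'| := by
      rw [abs_div, abs_neg, abs_of_nonneg (sq_nonneg (1 + lam t * eps t))]
      refine div_le_self (abs_nonneg _) ?_
      have : 0 < lam t * eps t := by positivity
      nlinarith
    have hk2 : c t * ‖V t‖ * (N *
      (|(-(l' * eps t + lam t * e') / (1 + lam t * eps t) ^ 2)| + |l' - e' / eps t ^ 2| / σ t))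
        ≤ c t * ‖V t‖ * ((|l' * eps t + lam t * e'| + |l' - e' / eps t ^ 2| / σ t) * N) := by
      rw [mul_comm N]
      have : 0 ≤ c t := by simp only [hc]; positivity
      gcongr
    refine main.trans ((add_le_add_right hk2 _).trans ?_)
    rw [hUV, hVt, hyq, inner_zero_right, norm_smul, mul_pow, Real.norm_eq_abs, sq_abs,
      inner_add_left q, real_inner_smul_left (x t)]
    apply le_of_eq
    simp only [hσ, hc]
    field_simp
    ring
  · simp only [Pi.add_apply, Pi.sub_apply, Pi.mul_apply]
    rw [hEeq t ⟨hlam0, heps0⟩, hUV]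
  · filter_upwards [nhdsWithin_le_nhds hev, nhdsWithin_le_nhds hydist, self_mem_nhdsWithin]
      with s hs hys hst
    have hpos : 0 < s - t := sub_pos.2 hst
    simp only [Pi.add_apply, Pi.sub_apply, Pi.mul_apply]
    rw [hEeq s hs]
    have hUs : U s = V s + c s • (y s - y t) := by simp only [hU, hV]; module
    have hcs : 0 ≤ c s := by simp only [hc]; positivity
    -- Expanding `‖V + c (y s - y t)‖²` and dropping the last square gives a bound linear in the
    -- displacement.
    have h1 : ‖V s‖ ^ 2 ≤ ‖U s‖ ^ 2 + 2 * (c s * ‖V s‖ * ‖y s - y t‖) := by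
      rw [hUs, norm_add_sq_real (V s) (c s • (y s - y t)), real_inner_smul_right]
      have h2 := neg_le_of_abs_le (abs_real_inner_le_norm (V s) (y s - y t))
      nlinarith [sq_nonneg ‖c s • (y s - y t)‖, mul_le_mul_of_nonneg_left h2 hcs]
    have h3 : (|ρ s - ρ t| + |σ s - σ t| / σ t) * N
        = N * (|slope ρ t s| + |slope σ t s| / σ t) * (s - t) := by
      rw [slope_def_field, slope_def_field, abs_div, abs_div, abs_of_pos hpos]
      field_simp
    rw [h3] at hys
    have h4 := mul_le_mul_of_nonneg_left hys (mul_nonneg hcs (norm_nonneg (V s)))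
    linarith
  · have hs1 := (hasDerivAt_iff_tendsto_slope.1 hρd).mono_left
      (nhdsWithin_mono t fun s (hs : t < s) => hs.ne')
    have hs2 := (hasDerivAt_iff_tendsto_slope.1 hσd).mono_left
      (nhdsWithin_mono t fun s (hs : t < s) => hs.ne')
    exact ((hcd.continuousAt.mul hVc.norm).tendsto.mono_left nhdsWithin_le_nhds).mul
      ((hs1.abs.add (hs2.abs.div_const _)).const_mul N)

end EnergyDerivative

/-! ### The dissipation inequality -/

section Dissipation

variable {H : Type*} [NormedAddCommGroup H]

lemma norm_sq_add_add_le (a b c : H) :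
    ‖a + b + c‖ ^ 2 ≤ 3 * (‖a‖ ^ 2 + ‖b‖ ^ 2 + ‖c‖ ^ 2) := by
  have h := norm_add₃_le (a := a) (b := b) (c := c)
  have h0 := norm_nonneg (a + b + c)
  nlinarith [sq_nonneg (‖a‖ - ‖b‖), sq_nonneg (‖b‖ - ‖c‖), sq_nonneg (‖a‖ - ‖c‖)]

variable [InnerProductSpace ℝ H]

set_option maxHeartbeats 1000000 in
/-- The dissipation inequality: the upper bound of the derivative of the energy is at most a
negative multiple of the energy, up to an error that is integrable against the decay. -/
lemma dissipation_le {x y w q p : H} {α β γ d l s t lam N L F k : ℝ}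
    (hβ : 0 < β) (hγ : 0 < γ) (hγα : γ < α) (hγα' : γ * (α - γ) ≤ 1 / 2)
    (hl : 0 ≤ l) (hl2 : l ≤ 2) (hd : 0 ≤ d) (hd2 : d ≤ 2) (hs : 0 < s) (ht : 1 ≤ t)
    (hlam : 0 < lam) (hlams : lam * s ^ 2 ≤ 1) (hst : s ^ 2 * t ≤ 1) (hst4 : 4 ≤ t * s)
    (hstk : 2 * γ ≤ k * (t * s)) (hy : ‖y‖ ≤ N) (hp : ‖p‖ ≤ N) (hL : L ≤ 6 / t)
    (hF0 : 0 ≤ F) (hF : F + s ^ 2 / 2 * ‖x - y‖ ^ 2 ≤ ⟪x - y, q + s ^ 2 • x⟫)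
    (hq : 0 ≤ ⟪q, x - p⟫) (hk : 0 < k) (hk1 : 3 * k * γ ≤ 1 / 8) (hk2 : 3 * k ≤ (α - γ) / 8)
    (hk3 : k / 2 ≤ γ) (hs1 : 3 * k * β * s ≤ 1 / 8) (hs2 : 2 * β * (α - γ) * s ≤ 1 / 8) :
    ⟪q + s ^ 2 • x, w⟫ - l * lam / t / 2 * ‖q‖ ^ 2 + -(d * s ^ 2 / t) / 2 * ‖x‖ ^ 2
        + (l * lam / t * (s ^ 2) ^ 2 - -(d * s ^ 2 / t)) / 2 * ‖y‖ ^ 2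
        + ⟪(γ * s) • (x - y) + w + β • q,
          (γ * (-(d * s ^ 2 / t) / (2 * s))) • (x - y) + (γ * s) • w
            + (-((α * s) • w) - q - s ^ 2 • x)⟫
        + γ * s * ‖(γ * s) • (x - y) + w + β • q‖ * (L * N)
      ≤ -(k / 2 * s) * (F + 1 / 2 * ‖(γ * s) • (x - y) + w + β • q‖ ^ 2)
        + (2 + β + 36 * γ ^ 2 / k) * N ^ 2 * (s ^ 2 / t) := by
  have ht0 : 0 < t := by linarith
  have hN : 0 ≤ N := (norm_nonneg _).trans hy
  have hst0 : 0 < s ^ 2 / t := by positivity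
  set u := x - y with hu
  set g := q + s ^ 2 • x with hg
  set v := (γ * s) • u + w + β • q with hv
  set U := s * ‖u‖ with hU
  set X := ‖w‖
  set Q := ‖q‖
  set V := ‖v‖ with hV
  have hU0 : 0 ≤ U := by positivity
  have hX0 : 0 ≤ X := norm_nonneg _
  have hQ0 : 0 ≤ Q := norm_nonneg _
  have hV0 : 0 ≤ V := norm_nonneg _
  have hδ : 0 < α - γ := by linarith
  have e0 : (γ * (-(d * s ^ 2 / t) / (2 * s))) • u + (γ * s) • w
      + (-((α * s) • w) - q - s ^ 2 • x)
      = (-(γ * d * s / (2 * t))) • u - ((α - γ) * s) • w - g := by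
    have : γ * (-(d * s ^ 2 / t) / (2 * s)) = -(γ * d * s / (2 * t)) := by field_simp
    rw [this, hg]; module
  have e1 : ⟪v, (-(γ * d * s / (2 * t))) • u - ((α - γ) * s) • w - g⟫
      = -(γ * d * s / (2 * t) * ⟪v, u⟫) - (α - γ) * s * (γ * s * ⟪u, w⟫ + X ^ 2 + β * ⟪q, w⟫)
        - (γ * s * ⟪u, g⟫ + ⟪w, g⟫ + β * ⟪q, g⟫) := by
    rw [inner_sub_right, inner_sub_right, inner_smul_right, inner_smul_right]
    have a1 : ⟪v, w⟫ = γ * s * ⟪u, w⟫ + X ^ 2 + β * ⟪q, w⟫ := by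
      rw [hv, inner_add_left, inner_add_left, real_inner_smul_left, real_inner_smul_left,
        real_inner_self_eq_norm_sq]
    have a2 : ⟪v, g⟫ = γ * s * ⟪u, g⟫ + ⟪w, g⟫ + β * ⟪q, g⟫ := by
      rw [hv, inner_add_left, inner_add_left, real_inner_smul_left, real_inner_smul_left]
    rw [a1, a2]; ring
  -- This term cancels against the derivative of `φ` along the velocity.
  have e2 : ⟪w, g⟫ = ⟪g, w⟫ := real_inner_comm _ _
  -- the cross term of `v` and `u`
  have s1 : -(γ * d * s / (2 * t) * ⟪v, u⟫) ≤ s * (k / 4 * V ^ 2 + γ / 8 * U ^ 2) := by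
    have b1 := neg_le_of_abs_le (abs_real_inner_le_norm v u)
    have b2 : -(γ * d * s / (2 * t) * ⟪v, u⟫) ≤ γ * d * s / (2 * t) * (V * ‖u‖) := by
      have : 0 ≤ γ * d * s / (2 * t) := by positivity
      have := mul_le_mul_of_nonneg_left b1 this
      linarith
    have b3 : γ * d * s / (2 * t) * (V * ‖u‖) ≤ γ / t * (V * U) := by
      have : γ * d * s / (2 * t) * (V * ‖u‖) = d / 2 * (γ / t * (V * U)) := by
        simp only [hU]; field_simp
      rw [this]
      have h0 : 0 ≤ γ / t * (V * U) := by positivity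
      exact mul_le_of_le_one_left h0 (by linarith)
    have b4 : γ / t ≤ s * (k / 2) := by
      rw [div_le_iff₀ ht0]; linarith
    have b5 : γ / t ≤ s * (γ / 4) := by
      rw [div_le_iff₀ ht0]; linarith [mul_le_mul_of_nonneg_left hst4 hγ.le]
    have b6 : γ / t * (V * U) ≤ γ / t * ((V ^ 2 + U ^ 2) / 2) := by
      have : V * U ≤ (V ^ 2 + U ^ 2) / 2 := by linarith [sq_nonneg (V - U)]
      gcongr
    have b7 := mul_le_mul_of_nonneg_right b4 (sq_nonneg V)
    have b8 := mul_le_mul_of_nonneg_right b5 (sq_nonneg U)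
    linarith
  have s2 : -((α - γ) * s * (γ * s * ⟪u, w⟫)) ≤ s * (γ / 4 * U ^ 2 + (α - γ) / 2 * X ^ 2) := by
    have b1 := neg_le_of_abs_le (abs_real_inner_le_norm u w)
    have b2 : -((α - γ) * s * (γ * s * ⟪u, w⟫)) ≤ s * ((α - γ) * γ * (U * X)) := by
      have : 0 ≤ (α - γ) * s * (γ * s) := by positivity
      have := mul_le_mul_of_nonneg_left b1 this
      simp only [hU]; linarith
    refine b2.trans (mul_le_mul_of_nonneg_left ?_ hs.le)
    -- The only place where `2γ(α - γ) ≤ 1` enters: it keeps this cross term within its share of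
    -- `U²`.
    have b3 : (α - γ) * γ ^ 2 * U ^ 2 ≤ γ / 2 * U ^ 2 :=
      mul_le_mul_of_nonneg_right (by linarith [mul_le_mul_of_nonneg_left hγα' hγ.le])
        (sq_nonneg U)
    linarith [mul_nonneg hδ.le (sq_nonneg (X - γ * U))]
  have s3 : -((α - γ) * s * (β * ⟪q, w⟫)) ≤ s * ((α - γ) / 8 * X ^ 2) + β / 8 * Q ^ 2 := by
    have b1 := neg_le_of_abs_le (abs_real_inner_le_norm q w)
    have b2 : -((α - γ) * s * (β * ⟪q, w⟫)) ≤ (α - γ) * s * (β * (Q * X)) := by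
      have : 0 ≤ (α - γ) * s * β := by positivity
      have := mul_le_mul_of_nonneg_left b1 this
      linarith
    have b3 : (α - γ) * s * (β * (Q * X))
        ≤ (α - γ) * s * (X ^ 2 / 8 + 2 * β ^ 2 * Q ^ 2) := by
      have : β * (Q * X) ≤ X ^ 2 / 8 + 2 * β ^ 2 * Q ^ 2 := by
        linarith [sq_nonneg (X - 4 * (β * Q))]
      have : 0 ≤ (α - γ) * s := by positivity
      gcongr
    have b4 := mul_le_mul_of_nonneg_right hs2 (mul_nonneg hβ.le (sq_nonneg Q))
    linarith
  have s4 : -(β * ⟪q, g⟫) ≤ -(3 / 4 * β * Q ^ 2) + β * N ^ 2 * (s ^ 2 / t) := by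
    have b1 : ⟪q, g⟫ = Q ^ 2 + s ^ 2 * ⟪q, x⟫ := by
      rw [hg, inner_add_right, real_inner_self_eq_norm_sq, inner_smul_right]
    have b2 : -(Q * N) ≤ ⟪q, x⟫ := by
      rw [inner_sub_right] at hq
      have := neg_le_of_abs_le (abs_real_inner_le_norm q p)
      have := mul_le_mul_of_nonneg_left hp hQ0
      linarith
    -- Here `ε t ≤ 1`, that is `d ≥ 1`, makes the Tikhonov error as small as `s² / t`.
    have b3 : s ^ 2 * s ^ 2 ≤ s ^ 2 / t := by
      rw [le_div_iff₀ ht0]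
      linarith [mul_le_mul_of_nonneg_left hst (sq_nonneg s)]
    have b4 : -(s ^ 2 * ⟪q, x⟫) ≤ Q ^ 2 / 4 + s ^ 2 * s ^ 2 * N ^ 2 := by
      have := mul_le_mul_of_nonneg_left b2 (sq_nonneg s)
      linarith [sq_nonneg (Q / 2 - s ^ 2 * N)]
    have b5 := mul_le_mul_of_nonneg_right b3 (sq_nonneg N)
    rw [b1]
    have := mul_le_mul_of_nonneg_left (b4.trans (by linarith :
      _ ≤ Q ^ 2 / 4 + s ^ 2 / t * N ^ 2)) hβ.le
    linarith
  have s5 : -(γ * s * ⟪u, g⟫) ≤ -(γ * s * F) - s * (γ / 2 * U ^ 2) := by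
    have b1 : s ^ 2 / 2 * ‖u‖ ^ 2 = U ^ 2 / 2 := by simp only [hU]; ring
    rw [b1] at hF
    have := mul_le_mul_of_nonneg_left hF (mul_pos hγ hs).le
    linarith
  have s6 : γ * s * V * (L * N) ≤ s * (k / 4 * V ^ 2) + 36 * γ ^ 2 / k * N ^ 2 * (s ^ 2 / t) := by
    have b1 : γ * s * V * (L * N) ≤ γ * s * V * (6 / t * N) := by gcongr
    have b2 : γ * V * (6 / t * N) ≤ k / 4 * V ^ 2 + 36 * γ ^ 2 / k * N ^ 2 * (1 / t) ^ 2 := by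
      have e : k / 4 * V ^ 2 + 36 * γ ^ 2 / k * N ^ 2 * (1 / t) ^ 2 - γ * V * (6 / t * N)
          = 1 / k * (k * V / 2 - 6 * γ * N / t) ^ 2 := by
        field_simp; ring
      have : 0 ≤ 1 / k * (k * V / 2 - 6 * γ * N / t) ^ 2 := by positivity
      linarith
    have b3 : s * (1 / t) ^ 2 ≤ s ^ 2 / t := by
      rw [div_pow, one_pow, mul_one_div, div_le_div_iff₀ (by positivity) ht0]
      linarith [mul_le_mul_of_nonneg_left (by linarith : 1 ≤ t * s) (mul_pos hs ht0).le]
    have b4 : 0 ≤ 36 * γ ^ 2 / k * N ^ 2 := by positivity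
    have b5 := mul_le_mul_of_nonneg_left b2 hs.le
    have b6 := mul_le_mul_of_nonneg_left b3 b4
    linarith
  -- The square of the energy's vector is charged to its three components; smallness of `k` and of
  -- `s` fits it into the budget.
  have s7 : k * s * V ^ 2 ≤ s * (γ / 8 * U ^ 2 + (α - γ) / 8 * X ^ 2) + β / 8 * Q ^ 2 := by
    have b1 := norm_sq_add_add_le ((γ * s) • u) w (β • q)
    rw [← hv, norm_smul, norm_smul, mul_pow, mul_pow, Real.norm_eq_abs, Real.norm_eq_abs, sq_abs,
      sq_abs] at b1
    have b2 : (γ * s) ^ 2 * ‖u‖ ^ 2 = γ ^ 2 * U ^ 2 := by simp only [hU]; ring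
    rw [b2] at b1
    have b3 := mul_le_mul_of_nonneg_left b1 (mul_pos hk hs).le
    have b4 := mul_le_mul_of_nonneg_right hk1
      (mul_nonneg (mul_nonneg hs.le hγ.le) (sq_nonneg U))
    have b5 := mul_le_mul_of_nonneg_right hk2 (mul_nonneg hs.le (sq_nonneg X))
    have b6 := mul_le_mul_of_nonneg_right hs1 (mul_nonneg hβ.le (sq_nonneg Q))
    linarith
  have s8 : (l * lam / t * (s ^ 2) ^ 2 - -(d * s ^ 2 / t)) / 2 * ‖y‖ ^ 2
      ≤ 2 * N ^ 2 * (s ^ 2 / t) := by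
    have b1 : l * lam / t * (s ^ 2) ^ 2 - -(d * s ^ 2 / t)
        = (l * (lam * s ^ 2) + d) * (s ^ 2 / t) := by field_simp; ring
    have b2 : l * (lam * s ^ 2) + d ≤ 4 := by
      linarith [mul_le_mul_of_nonneg_left hlams hl]
    rw [b1]
    have b3 : (l * (lam * s ^ 2) + d) * (s ^ 2 / t) / 2 ≤ 2 * (s ^ 2 / t) := by
      linarith [mul_le_mul_of_nonneg_right b2 hst0.le]
    have b4 : ‖y‖ ^ 2 ≤ N ^ 2 := by gcongr
    calc _ ≤ 2 * (s ^ 2 / t) * N ^ 2 := by gcongr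
      _ = _ := by ring
  have s9 : 0 ≤ l * lam / t / 2 * Q ^ 2 := by positivity
  have s10 : 0 ≤ d * s ^ 2 / t / 2 * ‖x‖ ^ 2 := by positivity
  have s11 : k / 2 * s * F ≤ γ * s * F := by gcongr
  have s12 : 0 ≤ s * ((α - γ) / 4 * X ^ 2) := by positivity
  have s13 : 0 ≤ β / 2 * Q ^ 2 := by positivity
  have s14 : 0 ≤ k * s * V ^ 2 := by positivity
  rw [e0, e1, e2]
  linarith

end Dissipation

/-! ### The power functions `λ` and `ε` -/

section PowerParameters

lemma polyLam_pos (l : ℝ) {t : ℝ} (ht : 0 < t) : 0 < polyLam l t := Real.rpow_pos_of_pos ht l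

lemma polyEps_pos (d : ℝ) {t : ℝ} (ht : 0 < t) : 0 < polyEps d t :=
  one_div_pos.2 (Real.rpow_pos_of_pos ht d)

lemma one_div_polyEps (d t : ℝ) : 1 / polyEps d t = t ^ d := one_div_one_div _

lemma sqrt_polyEps (d : ℝ) {t : ℝ} (ht : 0 < t) : √(polyEps d t) = t ^ (-(d / 2)) := by
  rw [Real.sqrt_eq_iff_mul_self_eq (polyEps_pos d ht).le (by positivity), ← Real.rpow_add ht,
    polyEps, one_div, ← Real.rpow_neg ht.le]
  congr 1; ring

lemma sq_rpow_neg_half (d : ℝ) {t : ℝ} (ht : 0 < t) : (t ^ (-(d / 2))) ^ 2 = polyEps d t := by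
  rw [← sqrt_polyEps d ht, Real.sq_sqrt (polyEps_pos d ht).le]

lemma hasDerivAt_polyLam (l : ℝ) {t : ℝ} (ht : 0 < t) :
    HasDerivAt (polyLam l) (l * polyLam l t / t) t := by
  refine (Real.hasDerivAt_rpow_const (p := l) (Or.inl ht.ne')).congr_deriv ?_
  rw [Real.rpow_sub_one ht.ne', polyLam, mul_div_assoc]

lemma hasDerivAt_polyEps (d : ℝ) {t : ℝ} (ht : 0 < t) :
    HasDerivAt (polyEps d) (-(d * polyEps d t / t)) t := by
  have h := (hasDerivAt_polyLam d ht).inv (polyLam_pos d ht).ne'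
  have e : (polyLam d)⁻¹ = polyEps d := by
    ext s; simp [polyEps, polyLam]
  rw [e] at h
  refine h.congr_deriv ?_
  have := polyLam_pos d ht
  rw [polyEps, ← polyLam]
  field_simp

lemma lipOn_rpow (p : ℝ) {a b : ℝ} (ha : 0 < a) : LipOn (fun t : ℝ => t ^ p) a b := by
  have hne : ∀ t ∈ Icc a b, t ≠ 0 := fun t ht => (ha.trans_le ht.1).ne'
  refine LipOn.of_hasDerivAt (f' := fun t => p * t ^ (p - 1))
    (fun t ht => Real.hasDerivAt_rpow_const (Or.inl (hne t ht))) ?_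
  exact continuousOn_const.mul (continuousOn_id.rpow_const fun t ht => Or.inl (hne t ht))

lemma lipOn_polyEps (d : ℝ) {a b : ℝ} (ha : 0 < a) : LipOn (polyEps d) a b :=
  (lipOn_rpow (-d) ha).congr fun t ht => by
    rw [polyEps, one_div, Real.rpow_neg (ha.trans_le ht.1).le]

end PowerParameters

/-! ### Absolute continuity of the energy and its differential inequality -/

section EnergyRegularity

variable {H : Type*} [NormedAddCommGroup H] [InnerProductSpace ℝ H] [CompleteSpace H]
  {Φ : H → EReal}

lemma IsStrongSolution.hasDerivAt {lam eps : ℝ → ℝ} {α β t₀ : ℝ} {x : ℝ → H}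
    (hx : IsStrongSolution Φ lam eps α β t₀ x) {t : ℝ} (ht : t₀ < t) :
    HasDerivAt x (velocity t₀ x t) t :=
  (hx.differentiableOn t ht.le).hasDerivWithinAt.hasDerivAt (Ici_mem_nhds ht)

lemma IsStrongSolution.lipOn {lam eps : ℝ → ℝ} {α β t₀ : ℝ} {x : ℝ → H}
    (hx : IsStrongSolution Φ lam eps α β t₀ x) {a b : ℝ} (ha : t₀ < a) (hab : a ≤ b) :
    LipOn x a b := by
  refine LipOn.of_hasDerivAt (f' := velocity t₀ x)
    (fun t ht => hx.hasDerivAt (ha.trans_le ht.1)) ?_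
  have h := (hx.velocity_ac b (ha.le.trans hab)).continuousOn
  rw [uIcc_of_le (ha.le.trans hab)] at h
  exact h.mono (Icc_subset_Icc_left ha.le)

/-- Every ingredient except the velocity is Lipschitz on `[a, b]`; the velocity is absolutely
continuous by the notion of solution. Starting at `a ≥ 1` with `l ≥ 0` keeps the index at least 1.
-/
lemma IsProperConvexLsc.energy_ac (hΦ : IsProperConvexLsc Φ)
    (hmin : (argminSet Φ).Nonempty) {α β γ t₀ d l : ℝ} {x : ℝ → H}
    (hx : IsStrongSolution Φ (polyLam l) (polyEps d) α β t₀ x) (hl : 0 ≤ l)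
    {a b : ℝ} (ha : t₀ < a) (ha1 : 1 ≤ a) (hab : a ≤ b) :
    AbsolutelyContinuousOnInterval (energy Φ (polyLam l) (polyEps d) β γ t₀ x) a b := by
  have ha0 : 0 < a := by linarith
  have hpos : ∀ t ∈ Icc a b, 0 < t := fun t ht => ha0.trans_le ht.1
  have hge : ∀ t ∈ Icc a b, 1 ≤ t := fun t ht => ha1.trans ht.1
  have hxL := hx.lipOn ha hab
  have hlam : LipOn (polyLam l) a b := lipOn_rpow l ha0
  have heps : LipOn (polyEps d) a b := lipOn_polyEps d ha0
  have hsqrt : LipOn (fun t => √(polyEps d t)) a b :=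
    (lipOn_rpow (-(d / 2)) ha0).congr fun t ht => sqrt_polyEps d (hpos t ht)
  have hlam1 : ∀ t ∈ Icc a b, 1 ≤ polyLam l t := fun t ht => Real.one_le_rpow (hge t ht) hl
  have hσ : LipOn (fun t => polyLam l t + 1 / polyEps d t) a b :=
    (hlam.add (lipOn_rpow d ha0)).congr fun t _ => by rw [one_div_polyEps]
  have hσ1 : ∀ t ∈ Icc a b, 1 ≤ polyLam l t + 1 / polyEps d t := fun t ht => by
    have := hlam1 t ht
    have := one_div_pos.2 (polyEps_pos d (hpos t ht))
    linarith
  have hg : LipOn (envelopeGradient Φ (polyLam l) x) a b :=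
    (hΦ.lipOn_envGrad hmin hxL hlam hlam1).congr fun t ht =>
      hΦ.gradient_moreau hmin (polyLam_pos l (hpos t ht)) _
  have hy : LipOn (fun t => regularizedMinimizer Φ (polyEps d t) (polyLam l t)) a b := by
    refine LipOn.of_le (hlam.smul heps) hσ (norm_nonneg (minNormMinimizer Φ))
      (norm_nonneg (minNormMinimizer Φ)) fun s hs t ht => ?_
    have p1 := polyEps_pos d (hpos s hs)
    have p2 := polyLam_pos l (hpos s hs)
    have p3 := polyEps_pos d (hpos t ht)
    have p4 := polyLam_pos l (hpos t ht)
    have h := hΦ.regularizedMinimizer_sub_le hmin p1 p2 p3 p4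
    refine h.trans ?_
    rw [← mul_add, mul_comm]
    refine mul_le_mul_of_nonneg_left (add_le_add ?_ (div_le_self (abs_nonneg _) (hσ1 t ht)))
      (norm_nonneg _)
    have q1 : 0 < polyLam l s * polyEps d s := mul_pos p2 p1
    have q2 : 0 < polyLam l t * polyEps d t := mul_pos p4 p3
    rw [smul_eq_mul, smul_eq_mul, Real.norm_eq_abs, div_sub_div _ _ (by positivity) (by positivity),
      abs_div, abs_of_pos (by positivity : 0 < (1 + polyLam l s * polyEps d s)
        * (1 + polyLam l t * polyEps d t)), one_mul, mul_one, add_sub_add_left_eq_sub,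
      abs_sub_comm]
    exact div_le_self (abs_nonneg _) (by nlinarith)
  have hA : LipOn (fun t => regularized Φ (polyEps d t) (polyLam l t) (x t)) a b := by
    have h := (hΦ.lipOn_moreau hmin hxL hlam hlam1).add
      ((LipOn.const (1 / 2 : ℝ)).smul (heps.smul (hxL.norm.smul hxL.norm)))
    refine h.congr fun t _ => ?_
    simp only [regularized, smul_eq_mul]
    ring
  have hB : LipOn (fun t => regularized Φ (polyEps d t) (polyLam l t)
      (regularizedMinimizer Φ (polyEps d t) (polyLam l t))) a b :=
    (hΦ.lipOn_moreau hmin (LipOn.const (0 : H)) hσ hσ1).congr fun t ht =>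
      (hΦ.regularizedMinimizer_spec hmin (polyEps_pos d (hpos t ht))
        (polyLam_pos l (hpos t ht))).2.2.1
  have hv : AbsolutelyContinuousOnInterval (velocity t₀ x) a b := by
    refine (hx.velocity_ac b (ha.le.trans hab)).mono ?_
    rw [uIcc_of_le hab, uIcc_of_le (ha.le.trans hab)]
    exact Icc_subset_Icc_left ha.le
  have hV := (((((LipOn.const γ).smul hsqrt).smul (hxL.sub hy)).absolutelyContinuous hab).fun_add
    hv).fun_add (((LipOn.const β).smul hg).absolutelyContinuous hab)
  have hN := absolutelyContinuousOnInterval_norm hV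
  have h := ((hA.sub hB).absolutelyContinuous hab).fun_add ((hN.fun_mul hN).const_mul (1 / 2))
  simp only [← sq] at h
  exact h

lemma IsProperConvexLsc.regularized_sub_min_nonneg (hΦ : IsProperConvexLsc Φ) (hmin : (argminSet Φ).Nonempty)
    {e μ : ℝ} (he : 0 < e) (hμ : 0 < μ) (x : H) :
    0 ≤ regularized Φ e μ x - regularized Φ e μ (regularizedMinimizer Φ e μ) := by
  have h := (hΦ.regularizedMinimizer_spec hmin he hμ).2.2.2 x
  have h1 : 0 ≤ e / 2 * ‖x - regularizedMinimizer Φ e μ‖ ^ 2 := by positivity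
  have h2 : 0 ≤ μ / 2 * ‖envGrad Φ μ x + e • regularizedMinimizer Φ e μ‖ ^ 2 := by positivity
  linarith

/-- The differential inequality satisfied by the energy at a time where the equation holds. -/
lemma IsProperConvexLsc.energy_deriv_le_of_equation (hΦ : IsProperConvexLsc Φ)
    (hmin : (argminSet Φ).Nonempty) {α β γ t₀ d l k t s E' : ℝ} {x : ℝ → H} {acc gd : H}
    (hβ : 0 < β) (hγ : 0 < γ) (hγα : γ < α) (hγα' : γ * (α - γ) ≤ 1 / 2)
    (hl : 0 ≤ l) (hld : l ≤ d) (hd1 : 1 ≤ d) (hd2 : d ≤ 2) (ht : 1 ≤ t)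
    (hsdef : s = t ^ (-(d / 2))) (hst4 : 4 ≤ t * s)
    (hstk : 2 * γ ≤ k * (t * s)) (hk : 0 < k) (hk1 : 3 * k * γ ≤ 1 / 8)
    (hk2 : 3 * k ≤ (α - γ) / 8)
    (hk3 : k / 2 ≤ γ) (hs1 : 3 * k * β * s ≤ 1 / 8) (hs2 : 2 * β * (α - γ) * s ≤ 1 / 8)
    (hx : HasDerivAt x (velocity t₀ x t) t) (hv : HasDerivAt (velocity t₀ x) acc t)
    (hg : HasDerivAt (envelopeGradient Φ (polyLam l) x) gd t)
    (heq : acc + (α * √(polyEps d t)) • velocity t₀ x t + β • gd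
      + envelopeGradient Φ (polyLam l) x t + polyEps d t • x t = 0)
    (hE : HasDerivAt (energy Φ (polyLam l) (polyEps d) β γ t₀ x) E' t) :
    E' ≤ -(k / 2 * s) * energy Φ (polyLam l) (polyEps d) β γ t₀ x t
      + (2 + β + 36 * γ ^ 2 / k) * ‖minNormMinimizer Φ‖ ^ 2 * (s ^ 2 / t) := by
  have ht0 : 0 < t := by linarith
  have hs : 0 < s := hsdef ▸ Real.rpow_pos_of_pos ht0 _
  have hlam0 := polyLam_pos l ht0
  have heps0 := polyEps_pos d ht0
  have hes : polyEps d t = s ^ 2 := by rw [hsdef, sq_rpow_neg_half d ht0]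
  have hsq : √(polyEps d t) = s := by rw [sqrt_polyEps d ht0, hsdef]
  have hgt : envelopeGradient Φ (polyLam l) x t = envGrad Φ (polyLam l t) (x t) :=
    hΦ.gradient_moreau hmin hlam0 (x t)
  have main := hΦ.energy_deriv_le hmin hγ.le (hasDerivAt_polyLam l ht0) (hasDerivAt_polyEps d ht0)
    hlam0 heps0 rfl hx hv hg hE
  have hlow := hΦ.regularized_lower hmin (e := polyEps d t) hlam0 (x t)
    (regularizedMinimizer Φ (polyEps d t) (polyLam l t))
  have hF0 := hΦ.regularized_sub_min_nonneg hmin heps0 hlam0 (x t)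
  have hyN := (hΦ.regularizedMinimizer_le hmin heps0 hlam0).1
  have hw := (hΦ.minNormMinimizer_spec hmin).1
  have hqp : 0 ≤ ⟪envGrad Φ (polyLam l t) (x t), x t - minNormMinimizer Φ⟫ :=
    le_trans (by positivity) (hΦ.inner_envGrad_ge hw hlam0 (x t))
  have hlams : polyLam l t * polyEps d t ≤ 1 := by
    rw [polyLam, polyEps, mul_one_div, div_le_one (by positivity)]
    exact Real.rpow_le_rpow_of_exponent_le ht hld
  have hst : polyEps d t * t ≤ 1 := by
    rw [polyEps, div_mul_eq_mul_div, one_mul, div_le_one (by positivity)]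
    simpa using Real.rpow_le_rpow_of_exponent_le ht hd1
  have hacc : acc + β • gd = -((α * s) • velocity t₀ x t) - envGrad Φ (polyLam l t) (x t)
      - s ^ 2 • x t := by
    rw [hsq, hes, hgt] at heq
    rw [← sub_eq_zero, ← heq]
    abel
  -- Each summand is at most `2 / t`, by `λ ε ≤ 1` and `0 ≤ l ≤ d ≤ 2`; the constant 6 leaves slack.
  have hLe : |l * polyLam l t / t * s ^ 2 + polyLam l t * -(d * s ^ 2 / t)|
      + |l * polyLam l t / t - -(d * s ^ 2 / t) / (s ^ 2) ^ 2| / (polyLam l t + 1 / s ^ 2)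
        ≤ 6 / t := by
    rw [hes] at hlams
    have a1 : l * polyLam l t / t * s ^ 2 + polyLam l t * -(d * s ^ 2 / t)
        = -((d - l) * (polyLam l t * s ^ 2) / t) := by field_simp; ring
    have a2 : |l * polyLam l t / t * s ^ 2 + polyLam l t * -(d * s ^ 2 / t)| ≤ 2 / t := by
      have : 0 < polyLam l t * s ^ 2 := by positivity
      rw [a1, abs_neg, abs_of_nonneg (div_nonneg (mul_nonneg (by linarith) this.le) ht0.le)]
      gcongr
      nlinarith
    have a3 : |l * polyLam l t / t - -(d * s ^ 2 / t) / (s ^ 2) ^ 2| / (polyLam l t + 1 / s ^ 2)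
        ≤ 2 / t := by
      have e : l * polyLam l t / t - -(d * s ^ 2 / t) / (s ^ 2) ^ 2
          = (l * polyLam l t + d * (1 / s ^ 2)) / t := by field_simp; ring
      have h1 : 0 < 1 / s ^ 2 := by positivity
      rw [e, abs_of_nonneg (by positivity), div_le_iff₀ (by positivity), div_mul_eq_mul_div]
      gcongr
      nlinarith
    have a4 : 6 / t = 2 / t + 2 / t + 2 / t := by ring
    have a5 : 0 < 2 / t := by positivity
    linarith
  rw [energy, hgt, hsq, hes]
  rw [hsq, hes] at main
  rw [hes] at hlow hF0 hyN hlams hst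
  rw [hacc] at main
  refine main.trans (dissipation_le hβ hγ hγα hγα' hl (hld.trans hd2) (by linarith) hd2 hs ht hlam0
    hlams hst hst4 hstk hyN le_rfl hLe hF0 ?_ hqp hk hk1 hk2 hk3 hs1 hs2)
  rw [real_inner_comm, ← neg_sub (regularizedMinimizer Φ (s ^ 2) (polyLam l t)) (x t), norm_neg,
    inner_neg_right]
  linarith

end EnergyRegularity

/-! ### Admissible constants -/

section Parameters

lemma tendsto_mul_rpow_neg_half {d : ℝ} (hd : d < 2) :
    Tendsto (fun t : ℝ => t * t ^ (-(d / 2))) atTop atTop := by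
  refine (tendsto_rpow_atTop (y := 1 - d / 2) (by linarith)).congr' ?_
  filter_upwards [eventually_gt_atTop 0] with t ht
  rw [sub_eq_add_neg, Real.rpow_add ht, Real.rpow_one]

lemma tendsto_rpow_neg_half {d : ℝ} (hd : 0 < d) :
    Tendsto (fun t : ℝ => t ^ (-(d / 2))) atTop (𝓝 0) :=
  tendsto_rpow_neg_atTop (by linarith)

lemma tendsto_polyLam_mul_polyEps {d l : ℝ} (h : l < d) :
    Tendsto (fun t => polyLam l t * polyEps d t) atTop (𝓝 0) := by
  refine (tendsto_rpow_neg_atTop (y := d - l) (by linarith)).congr' ?_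
  filter_upwards [eventually_gt_atTop 0] with t ht
  rw [polyLam, polyEps, mul_one_div, ← Real.rpow_sub ht, neg_sub]

lemma exists_gamma {α : ℝ} (hα : 0 < α) :
    ∃ γ : ℝ, α / 2 < γ ∧ γ < α ∧ 2 * γ * (α - γ) < 1 := by
  set η := min (α / 4) (1 / (4 * α)) with hη
  have h1 : η ≤ α / 4 := min_le_left _ _
  have h2 : η ≤ 1 / (4 * α) := min_le_right _ _
  have h0 : 0 < η := lt_min (by positivity) (by positivity)
  refine ⟨α - η, by linarith, by linarith, ?_⟩
  rw [le_div_iff₀ (by positivity)] at h2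
  nlinarith

lemma hasDerivAt_one_div_sqrt_polyEps (d : ℝ) {t : ℝ} (ht : 0 < t) :
    HasDerivAt (fun s => 1 / √(polyEps d s)) (d / 2 * t ^ (d / 2 - 1)) t := by
  refine (Real.hasDerivAt_rpow_const (p := d / 2) (Or.inl ht.ne')).congr_of_eventuallyEq ?_
  filter_upwards [lt_mem_nhds ht] with s hs
  rw [sqrt_polyEps d hs, Real.rpow_neg hs.le, one_div, inv_inv]

lemma parameterConditions {α β γ d l : ℝ} (hβ : 0 < β) (hd₁ : 1 ≤ d) (hd₂ : d < 2) (hl : 0 ≤ l)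
    (hld : l < d) (hdβ : d = 1 → β < 1) (hγ : α / 2 < γ) (hγα : γ < α)
    (hγ' : 2 * γ * (α - γ) < 1) :
    ∃ a > 0, ∃ c > 0, ParameterConditions (polyLam l) (polyEps d) α β γ a c := by
  have hγ0 : 0 < γ := by linarith
  have hδ : 0 < α - γ := by linarith
  set η := (1 - 2 * γ * (α - γ)) / 2 with hη
  have hη0 : 0 < η := by simp only [hη]; linarith
  -- The third condition amounts to `2β ε t ≤ d (2 - γβ√ε)`. For `d = 1` the product `ε t` is 1,
  -- which is why `β < 1` is needed; for `d > 1` it tends to 0. The strict gap `2 - 2B` absorbs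
  -- `γβ√ε`.
  have hB : ∃ B < 1, ∀ᶠ t : ℝ in atTop, β * (polyEps d t * t) ≤ B := by
    rcases hd₁.eq_or_lt with h | h
    · refine ⟨β, hdβ h.symm, ?_⟩
      filter_upwards [eventually_gt_atTop 0] with t ht
      rw [← h, polyEps, Real.rpow_one, one_div_mul_cancel ht.ne', mul_one]
    · have h1 := (tendsto_polyLam_mul_polyEps h).const_mul β
      rw [mul_zero] at h1
      refine ⟨1 / 2, by norm_num, ?_⟩
      filter_upwards [h1.eventually (gt_mem_nhds (show (0 : ℝ) < 1 / 2 by norm_num))] with t ht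
      simp only [polyLam, Real.rpow_one] at ht
      rw [mul_comm (polyEps d t)]
      exact ht.le
  obtain ⟨B, hB1, hB⟩ := hB
  have hs := tendsto_rpow_neg_half (d := d) (by linarith)
  have small : ∀ c b : ℝ, 0 < b → ∀ᶠ t : ℝ in atTop, c * t ^ (-(d / 2)) ≤ b := fun c b hb => by
    have h := hs.const_mul c
    rw [mul_zero] at h
    filter_upwards [h.eventually (gt_mem_nhds hb)] with t ht using ht.le
  have small' : ∀ c b : ℝ, 0 < b → ∀ᶠ t : ℝ in atTop, c / t ≤ b := fun c b hb => by
    have h : Tendsto (fun t : ℝ => c / t) atTop (𝓝 0) := tendsto_const_nhds.div_atTop tendsto_id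
    filter_upwards [h.eventually (gt_mem_nhds hb)] with t ht using ht.le
  have small'' : ∀ b : ℝ, 0 < b → ∀ᶠ t : ℝ in atTop, d / 2 * t ^ (d / 2 - 1) ≤ b :=
    fun b hb => by
    have h := (tendsto_rpow_neg_atTop (y := 1 - d / 2) (by linarith)).const_mul (d / 2)
    rw [mul_zero] at h
    filter_upwards [h.eventually (gt_mem_nhds hb)] with t ht
    rw [neg_sub] at ht
    exact ht.le
  -- With this `a`, `α - γ (a + 1) / a` equals `(α - γ) / 2`, which is positive.
  set a := 2 * γ / (α - γ) with ha
  have ha0 : 0 < a := by positivity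
  have hγa : γ / a = (α - γ) / 2 := by rw [ha]; field_simp
  -- With this `c`, `γ / c` uses half of the gap in `2γ(α - γ) < 1`, leaving `-η`.
  set c := γ / η with hc
  have hγc : γ / c = η := by rw [hc]; field_simp
  refine ⟨a, ha0, c, by positivity, tendsto_polyLam_mul_polyEps hld, ?_⟩
  filter_upwards [eventually_ge_atTop 1, hB, small (γ * β) (2 - 2 * B) (by linarith),
    small ((γ / a + 2 * (α - γ)) * β ^ 2) (β / 2) (by linarith),
    small' (3 * β ^ 2 * d / 2) (β / 2) (by linarith), small' (β * d) η hη0,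
    small'' (2 * γ - α) (by linarith), small'' ((α - γ) / 2) (by linarith)]
    with t ht h1 h2 h3 h4 h5 h6 h7
  have ht0 : 0 < t := by linarith
  have he := polyEps_pos d ht0
  have hlam := polyLam_pos l ht0
  rw [(hasDerivAt_one_div_sqrt_polyEps d ht0).deriv, (hasDerivAt_polyEps d ht0).deriv,
    (hasDerivAt_polyLam l ht0).deriv, sqrt_polyEps d ht0, hγc]
  set s := t ^ (-(d / 2))
  set e := polyEps d t
  have hs0 : 0 < s := Real.rpow_pos_of_pos ht0 _
  have e1 : ∀ c : ℝ, c * -(d * e / t) / (2 * e) = -(c * d / (2 * t)) := fun c => by field_simp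
  rw [e1, e1]
  refine ⟨le_min ?_ ?_, ?_, ?_, ?_⟩
  · have : 0 ≤ γ * β * d / (2 * t) := by positivity
    linarith
  · have : γ * ((a + 1) / a) = γ + γ / a := by field_simp
    rw [this, hγa]; linarith
  · have h8 : β * -(d * e / t) = -(β * d / t * e) := by ring
    have h9 : 2 * γ * (α - γ) + η - 1 = -η := by simp only [hη]; ring
    rw [h8, h9]
    have := mul_le_mul_of_nonneg_right h5 he.le
    linarith
  · have h8 : 2 * β * e ^ 2 + (2 - γ * β * s) * -(d * e / t)
        = (2 * (β * (e * t)) - d * (2 - γ * β * s)) * (e / t) := by field_simp; ring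
    have h9 : 0 < β * (e * t) := by positivity
    have h10 : 2 * (β * (e * t)) - d * (2 - γ * β * s) ≤ 0 := by nlinarith
    rw [h8]
    exact mul_nonpos_of_nonpos_of_nonneg h10 (by positivity)
  · have h8 : 0 ≤ l * polyLam l t / t := by positivity
    have h9 : 3 * β ^ 2 * d / (2 * t) = 3 * β ^ 2 * d / 2 / t := by field_simp
    rw [h9]
    linarith

end Parameters

/-! ### Decay of the energy and the resulting rates -/

section Rates

variable {H : Type*} [NormedAddCommGroup H] [InnerProductSpace ℝ H] [CompleteSpace H]
  {Φ : H → EReal}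

lemma exists_dissipation_rate {γ δ : ℝ} (hγ : 0 < γ) (hδ : 0 < δ) :
    ∃ k : ℝ, 0 < k ∧ 3 * k * γ ≤ 1 / 8 ∧ 3 * k ≤ δ / 8 ∧ k / 2 ≤ γ := by
  refine ⟨min (1 / (24 * γ)) (min (δ / 24) (2 * γ)), lt_min (by positivity)
    (lt_min (by positivity) (by positivity)), ?_, ?_, ?_⟩
  · have h : min (1 / (24 * γ)) (min (δ / 24) (2 * γ)) ≤ 1 / (24 * γ) := min_le_left _ _
    rw [le_div_iff₀ (by positivity)] at h
    linarith
  · have h : min (1 / (24 * γ)) (min (δ / 24) (2 * γ)) ≤ δ / 24 :=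
      (min_le_right _ _).trans (min_le_left _ _)
    linarith
  · have h : min (1 / (24 * γ)) (min (δ / 24) (2 * γ)) ≤ 2 * γ :=
      (min_le_right _ _).trans (min_le_right _ _)
    linarith

/-- The decay of the energy. -/
lemma IsProperConvexLsc.energy_le (hΦ : IsProperConvexLsc Φ)
    (hmin : (argminSet Φ).Nonempty) {α β γ t₀ d l : ℝ} {x : ℝ → H}
    (hx : IsStrongSolution Φ (polyLam l) (polyEps d) α β t₀ x) (hβ : 0 < β) (hγ : 0 < γ)
    (hγα : γ < α) (hγα' : γ * (α - γ) ≤ 1 / 2) (hl : 0 ≤ l) (hld : l ≤ d) (hd1 : 1 ≤ d)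
    (hd2 : d < 2) :
    ∃ K > 0, ∃ T, ∀ t ≥ T,
      energy Φ (polyLam l) (polyEps d) β γ t₀ x t ≤ K / t ^ (d / 2 + 1) := by
  obtain ⟨k, hk, hk1, hk2, hk3⟩ := exists_dissipation_rate hγ (sub_pos.2 hγα)
  have hts := tendsto_mul_rpow_neg_half hd2
  have hs := tendsto_rpow_neg_half (d := d) (by linarith)
  have small : ∀ c : ℝ, ∀ᶠ t : ℝ in atTop, c * t ^ (-(d / 2)) ≤ 1 / 8 := fun c => by
    have h := hs.const_mul c
    rw [mul_zero] at h
    filter_upwards [h.eventually (gt_mem_nhds (show (0 : ℝ) < 1 / 8 by norm_num))] with t ht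
    exact ht.le
  -- As `d < 2`, `t s` tends to infinity. The thresholds 4 and `2γ / k` serve the dissipation
  -- inequality; `8 / k` serves the supersolution estimate.
  obtain ⟨T, hT⟩ := eventually_atTop.1 (((eventually_gt_atTop t₀).and (eventually_ge_atTop 1)).and
    ((((hts.eventually_ge_atTop 4).and (hts.eventually_ge_atTop (2 * γ / k))).and
      (hts.eventually_ge_atTop (8 / k))).and ((small (3 * k * β)).and
      (small (2 * β * (α - γ))))))
  have hT0 : t₀ < T := (hT T le_rfl).1.1
  have hT1 : 1 ≤ T := (hT T le_rfl).1.2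
  have hTpos : 0 < T := by linarith
  set C := (2 + β + 36 * γ ^ 2 / k) * ‖minNormMinimizer Φ‖ ^ 2 with hC
  set E := energy Φ (polyLam l) (polyEps d) β γ t₀ x with hE
  set p := d / 2 + 1 with hp
  -- The first entry lets the decay absorb the error term, the second puts the comparison function
  -- above the energy at `T`, and the `+ 1` ensures positivity.
  set K := max (4 * C / k) (E T * T ^ p) + 1 with hK
  have hC0 : 0 ≤ C := by positivity
  have hK1 : 4 * C / k ≤ K := by simp only [hK]; linarith [le_max_left (4 * C / k) (E T * T ^ p)]
  have hK2 : E T * T ^ p ≤ K := by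
    simp only [hK]; linarith [le_max_right (4 * C / k) (E T * T ^ p)]
  have hK0 : 0 < K := by
    have : 0 ≤ 4 * C / k := by positivity
    simp only [hK]; linarith [le_max_left (4 * C / k) (E T * T ^ p)]
  refine ⟨K, hK0, T, fun b hb => ?_⟩
  have hb' : K / b ^ p = K * polyEps p b := by rw [polyEps, mul_one_div]
  rw [hb']
  have hpos : ∀ t ∈ Icc T b, 0 < t := fun t ht => hTpos.trans_le ht.1
  have hr : 0 < 1 - d / 2 := by linarith
  have hRd : ∀ t ∈ Icc T b, HasDerivAt (fun t : ℝ => k / 2 / (1 - d / 2) * t ^ (1 - d / 2))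
      (k / 2 * t ^ (-(d / 2))) t := fun t ht => by
    have h := (Real.hasDerivAt_rpow_const (x := t) (p := 1 - d / 2)
      (Or.inl (hpos t ht).ne')).const_mul (k / 2 / (1 - d / 2))
    refine h.congr_deriv ?_
    rw [show 1 - d / 2 - 1 = -(d / 2) by ring, ← mul_assoc, div_mul_cancel₀ _ hr.ne']
  have hRac : AbsolutelyContinuousOnInterval
      (fun t : ℝ => Real.exp (k / 2 / (1 - d / 2) * t ^ (1 - d / 2))) T b := by
    refine LipOn.absolutelyContinuous (LipOn.of_hasDerivAt (fun t ht => (hRd t ht).exp) ?_) hb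
    have h1 : ContinuousOn (fun t : ℝ => t ^ (1 - d / 2)) (Icc T b) :=
      continuousOn_id.rpow_const fun t ht => Or.inl (hpos t ht).ne'
    have h2 : ContinuousOn (fun t : ℝ => t ^ (-(d / 2))) (Icc T b) :=
      continuousOn_id.rpow_const fun t ht => Or.inl (hpos t ht).ne'
    exact ((continuousOn_const.mul h1).rexp).mul (continuousOn_const.mul h2)
  refine le_of_ae_deriv_le (h := fun t => K * polyEps p t)
    (h' := fun t => K * (-(p * polyEps p t / t)))
    (R := fun t => k / 2 / (1 - d / 2) * t ^ (1 - d / 2)) (ρ := fun t => k / 2 * t ^ (-(d / 2))) hb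
    (hΦ.energy_ac hmin hx hl hT0 hT1 hb)
    (((lipOn_polyEps p hTpos).absolutelyContinuous hb).const_mul K) hRac
    (fun t ht => (hasDerivAt_polyEps p (hpos t (Ioo_subset_Icc_self ht))).const_mul K)
    (fun t ht => hRd t (Ioo_subset_Icc_self ht)) ?_ ?_
  · filter_upwards [(ae_restrict_iff' measurableSet_Ioi).1 hx.equation] with t heq ht E' hE'
    obtain ⟨⟨ht0, ht1⟩, ⟨⟨c1, c2⟩, c3⟩, c4, c5⟩ := hT t ht.1.le
    obtain ⟨acc, gd, hv, hg, heq⟩ := heq ht0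
    have htpos : 0 < t := by linarith
    rw [div_le_iff₀ hk] at c2 c3
    have h := hΦ.energy_deriv_le_of_equation hmin hβ hγ hγα hγα' hl hld hd1 hd2.le ht1 rfl c1
      (by linarith) hk hk1 hk2 hk3 c4 c5 (hx.hasDerivAt ht0) hv hg heq hE'
    have hpe : polyEps p t = t ^ (-(d / 2)) / t := by
      rw [hp, polyEps, one_div, ← Real.rpow_neg htpos.le, neg_add, Real.rpow_add htpos,
        Real.rpow_neg_one]
      exact (div_eq_mul_inv _ _).symm
    set s : ℝ := t ^ (-(d / 2))
    have hs0 : 0 < s := Real.rpow_pos_of_pos htpos _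
    -- Supersolution property of `K t ^ (-p)`: the error and the derivative of the comparison
    -- function each use at most half of the decay.
    have key : C * (s ^ 2 / t) + K * (p * (s / t) / t) ≤ k / 2 * s * (K * (s / t)) := by
      have d1 : C * (s ^ 2 / t) + K * (p * (s / t) / t) = (C * (t * s) + K * p) * (s / t ^ 2) := by
        field_simp
      have d2 : k / 2 * s * (K * (s / t)) = (k / 2 * K * (t * s)) * (s / t ^ 2) := by
        field_simp
      rw [d1, d2]
      refine mul_le_mul_of_nonneg_right ?_ (by positivity)
      rw [div_le_iff₀ hk] at hK1
      have d3 : 4 * C * (t * s) ≤ K * k * (t * s) :=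
        mul_le_mul_of_nonneg_right hK1 (by positivity)
      have d4 : K * p ≤ K * 2 := mul_le_mul_of_nonneg_left (by simp only [hp]; linarith) hK0.le
      have d5 := mul_le_mul_of_nonneg_left c3 hK0.le
      linarith
    simp only [hpe]
    linarith
  · have : 0 < T ^ p := Real.rpow_pos_of_pos hTpos p
    simp only [polyEps, mul_one_div]
    rwa [le_div_iff₀ this]

/-- The rates that follow from a bound of the energy at a given time. -/
lemma IsProperConvexLsc.rates_of_energy_le (hΦ : IsProperConvexLsc Φ)
    (hmin : (argminSet Φ).Nonempty) {K d l t : ℝ} {x : H} (ht : 1 ≤ t) (hK : 0 < K)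
    (hd2 : d < 2)
    (hE : regularized Φ (1 / t ^ d) (t ^ l) x - regularized Φ (1 / t ^ d) (t ^ l)
      (regularizedMinimizer Φ (1 / t ^ d) (t ^ l)) ≤ K / t ^ (d / 2 + 1)) :
    moreau Φ (t ^ l) x - (⨅ y, Φ y).toReal
      ≤ 2 * K / t ^ (d / 2 + 1) + 1 / (2 * t ^ d) * ‖minNormMinimizer Φ‖ ^ 2 ∧
    Φ (prox Φ (t ^ l) x) - (⨅ y, Φ y)
      ≤ ((2 * K / t ^ (d / 2 + 1) + 1 / (2 * t ^ d) * ‖minNormMinimizer Φ‖ ^ 2 : ℝ) : EReal) ∧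
    ‖prox Φ (t ^ l) x - x‖ ^ 2
      ≤ 2 * (2 * K) * t ^ (l - d / 2 - 1) + t ^ (l - d) * ‖minNormMinimizer Φ‖ ^ 2 ∧
    ‖x - regularizedMinimizer Φ (1 / t ^ d) (t ^ l)‖ ^ 2 ≤ 2 * K / t ^ (1 - d / 2) ∧
    moreau Φ (t ^ l) x - (⨅ y, Φ y).toReal ≤ (2 * K + ‖minNormMinimizer Φ‖ ^ 2) / t ^ d ∧
    Φ (prox Φ (t ^ l) x) - (⨅ y, Φ y)
      ≤ (((2 * K + ‖minNormMinimizer Φ‖ ^ 2) / t ^ d : ℝ) : EReal) ∧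
    ‖prox Φ (t ^ l) x - x‖ ^ 2 ≤ (4 * K + 2 * ‖minNormMinimizer Φ‖ ^ 2) / t ^ (d - l) ∧
    (l ≤ 3 * d / 2 - 1 ∨ minNormMinimizer Φ = 0 →
      ‖prox Φ (t ^ l) x - x‖ ^ 2
        ≤ (4 * K + 2 * ‖minNormMinimizer Φ‖ ^ 2) / t ^ (d / 2 + 1 - l)) := by
  have ht0 : 0 < t := by linarith
  have hμ : 0 < t ^ l := Real.rpow_pos_of_pos ht0 l
  have htd : 0 < t ^ d := Real.rpow_pos_of_pos ht0 d
  have htp : 0 < t ^ (d / 2 + 1) := Real.rpow_pos_of_pos ht0 _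
  have he : 0 < 1 / t ^ d := by positivity
  obtain ⟨hyN, hyv⟩ := hΦ.regularizedMinimizer_le hmin he hμ
  have hspec := (hΦ.regularizedMinimizer_spec hmin he hμ).2.2.2 x
  obtain ⟨hval, -, -⟩ := hΦ.prox_spec hmin hμ x
  have hm := hΦ.moreau_eq hmin hμ x
  have hprox : ‖prox Φ (t ^ l) x - x‖ ^ 2
      = (t ^ l) ^ 2 * ‖envGrad Φ (t ^ l) x‖ ^ 2 := by
    rw [norm_sub_rev, norm_sub_prox_sq hμ]
  obtain ⟨z, hz⟩ := hmin
  obtain ⟨m, hzm, hmle⟩ := hΦ.exists_argmin_value hz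
  have hinf : (⨅ y, Φ y) = m := le_antisymm (hzm ▸ iInf_le _ z) (le_iInf hmle)
  rw [hinf, EReal.toReal_coe] at hyv ⊢
  set N := ‖minNormMinimizer Φ‖
  set y := regularizedMinimizer Φ (1 / t ^ d) (t ^ l)
  set q := envGrad Φ (t ^ l) x
  have hmv : m ≤ proxValue Φ (t ^ l) x := by
    have := hmle (prox Φ (t ^ l) x)
    rw [hval] at this
    exact_mod_cast this
  have hq0 : 0 ≤ t ^ l / 2 * ‖q‖ ^ 2 := by positivity
  have hxe : 0 ≤ 1 / t ^ d * ‖x‖ ^ 2 / 2 := by positivity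
  have hdec : 1 / t ^ (d / 2 + 1) ≤ 1 / t ^ d := by
    apply one_div_le_one_div_of_le htd
    exact Real.rpow_le_rpow_of_exponent_le ht (by linarith)
  have hKle : K / t ^ (d / 2 + 1) ≤ 2 * K / t ^ (d / 2 + 1) := by gcongr; linarith
  have hmor : moreau Φ (t ^ l) x - m ≤ 2 * K / t ^ (d / 2 + 1) + 1 / (2 * t ^ d) * N ^ 2 := by
    have e1 : 1 / t ^ d * N ^ 2 / 2 = 1 / (2 * t ^ d) * N ^ 2 := by field_simp
    rw [e1] at hyv
    rw [regularized] at hE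
    linarith
  have hmor' : 2 * K / t ^ (d / 2 + 1) + 1 / (2 * t ^ d) * N ^ 2 ≤ (2 * K + N ^ 2) / t ^ d := by
    have e1 : 1 / (2 * t ^ d) * N ^ 2 = N ^ 2 / 2 * (1 / t ^ d) := by field_simp
    have e2 : (2 * K + N ^ 2) / t ^ d = 2 * K * (1 / t ^ d) + N ^ 2 * (1 / t ^ d) := by ring
    have e3 : 2 * K / t ^ (d / 2 + 1) = 2 * K * (1 / t ^ (d / 2 + 1)) := by ring
    have h1 : 0 ≤ N ^ 2 * (1 / t ^ d) := by positivity
    have h2 : 2 * K * (1 / t ^ (d / 2 + 1)) ≤ 2 * K * (1 / t ^ d) := by gcongr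
    rw [e1, e2, e3]; linarith
  have hpv : proxValue Φ (t ^ l) x - m ≤ moreau Φ (t ^ l) x - m := by linarith
  have hΦv : Φ (prox Φ (t ^ l) x) - (m : EReal) = ((proxValue Φ (t ^ l) x - m : ℝ) : EReal) := by
    rw [hval, EReal.coe_sub]
  have r1 : t ^ l / t ^ (d / 2 + 1) = t ^ (l - d / 2 - 1) := by
    rw [← Real.rpow_sub ht0]; congr 1; ring
  have r2 : t ^ l / t ^ d = t ^ (l - d) := by rw [← Real.rpow_sub ht0]
  have hpr : ‖prox Φ (t ^ l) x - x‖ ^ 2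
      ≤ 2 * (2 * K) * t ^ (l - d / 2 - 1) + t ^ (l - d) * N ^ 2 := by
    have h1 : (t ^ l) ^ 2 * ‖q‖ ^ 2 ≤ 2 * t ^ l * (moreau Φ (t ^ l) x - m) := by
      have := mul_le_mul_of_nonneg_left
        (by linarith : t ^ l / 2 * ‖q‖ ^ 2 ≤ moreau Φ (t ^ l) x - m)
        (by positivity : 0 ≤ 2 * t ^ l)
      linarith
    have h2 := mul_le_mul_of_nonneg_left hmor (by positivity : 0 ≤ 2 * t ^ l)
    have e1 : 2 * t ^ l * (2 * K / t ^ (d / 2 + 1) + 1 / (2 * t ^ d) * N ^ 2)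
        = 2 * (2 * K) * (t ^ l / t ^ (d / 2 + 1)) + (t ^ l / t ^ d) * N ^ 2 := by
      field_simp
    rw [e1, r1, r2] at h2
    rw [hprox]; linarith
  have r3 : ∀ c : ℝ, c / t ^ (d - l) = c * t ^ (l - d) := fun c => by
    rw [← neg_sub d l, Real.rpow_neg ht0.le, div_eq_mul_inv]
  have r4 : ∀ c : ℝ, c / t ^ (d / 2 + 1 - l) = c * t ^ (l - d / 2 - 1) := fun c => by
    rw [show l - d / 2 - 1 = -(d / 2 + 1 - l) by ring, Real.rpow_neg ht0.le, div_eq_mul_inv]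
  have hp1 : 0 < t ^ (l - d / 2 - 1) := Real.rpow_pos_of_pos ht0 _
  have hp2 : 0 < t ^ (l - d) := Real.rpow_pos_of_pos ht0 _
  refine ⟨hmor, ?_, hpr, ?_, hmor.trans hmor', ?_, ?_, ?_⟩
  · rw [hΦv, EReal.coe_le_coe_iff]
    exact hpv.trans hmor
  · have h1 : 0 ≤ t ^ l / 2 * ‖q + (1 / t ^ d) • y‖ ^ 2 := by positivity
    have h2 : 1 / t ^ d / 2 * ‖x - y‖ ^ 2 ≤ K / t ^ (d / 2 + 1) := by linarith
    have h3 := mul_le_mul_of_nonneg_left h2 (by positivity : 0 ≤ 2 * t ^ d)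
    have e1 : 2 * t ^ d * (1 / t ^ d / 2 * ‖x - y‖ ^ 2) = ‖x - y‖ ^ 2 := by field_simp
    have e2 : 2 * t ^ d * (K / t ^ (d / 2 + 1)) = 2 * K / t ^ (1 - d / 2) := by
      have : t ^ (d / 2 + 1) = t ^ d * t ^ (1 - d / 2) := by
        rw [← Real.rpow_add ht0]; congr 1; ring
      rw [this]; field_simp
    rwa [e1, e2] at h3
  · rw [hΦv, EReal.coe_le_coe_iff]
    exact hpv.trans (hmor.trans hmor')
  · rw [r3]
    have h1 : t ^ (l - d / 2 - 1) ≤ t ^ (l - d) :=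
      Real.rpow_le_rpow_of_exponent_le ht (by linarith)
    have h2 := mul_le_mul_of_nonneg_left h1 (by positivity : 0 ≤ 4 * K)
    have h3 : 0 ≤ t ^ (l - d) * N ^ 2 := by positivity
    linarith
  · intro hcase
    rw [r4]
    rcases hcase with hcase | hcase
    -- The gradient is near `-e • y`, and the energy controls `q + e • y` at the fast rate. The
    -- remainder contributes `t ^ (2 (l - d))`, dominated by `t ^ (l - d/2 - 1)` exactly when `l ≤
    -- 3d/2 - 1`.
    · have h1 : ‖q‖ ^ 2 ≤ 2 * ‖q + (1 / t ^ d) • y‖ ^ 2 + 2 * (1 / t ^ d) ^ 2 * N ^ 2 := by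
        have a1 : ‖q‖ ≤ ‖q + (1 / t ^ d) • y‖ + 1 / t ^ d * N := by
          have e1 : q = (q + (1 / t ^ d) • y) - (1 / t ^ d) • y := by abel
          have a2 := norm_sub_le (q + (1 / t ^ d) • y) ((1 / t ^ d) • y)
          rw [← e1, norm_smul, Real.norm_of_nonneg he.le] at a2
          have a3 := mul_le_mul_of_nonneg_left hyN he.le
          linarith
        have a4 := pow_le_pow_left₀ (norm_nonneg q) a1 2
        have a5 := sq_nonneg (‖q + (1 / t ^ d) • y‖ - 1 / t ^ d * N)
        linarith
      have h2 : t ^ l / 2 * ‖q + (1 / t ^ d) • y‖ ^ 2 ≤ K / t ^ (d / 2 + 1) := by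
        have : 0 ≤ 1 / t ^ d / 2 * ‖x - y‖ ^ 2 := by positivity
        linarith
      have h3 := mul_le_mul_of_nonneg_left h2 (by positivity : 0 ≤ 4 * t ^ l)
      have e1 : 4 * t ^ l * (K / t ^ (d / 2 + 1)) = 4 * K * (t ^ l / t ^ (d / 2 + 1)) := by ring
      rw [e1, r1] at h3
      have h4 := mul_le_mul_of_nonneg_left h1 (sq_nonneg (t ^ l))
      have e2 : (t ^ l) ^ 2 * (2 * (1 / t ^ d) ^ 2 * N ^ 2) = 2 * N ^ 2 * (t ^ (l - d)) ^ 2 := by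
        rw [← r2]; field_simp
      have h5 : (t ^ (l - d)) ^ 2 ≤ t ^ (l - d / 2 - 1) := by
        rw [sq, ← Real.rpow_add ht0]
        exact Real.rpow_le_rpow_of_exponent_le ht (by linarith)
      have h6 := mul_le_mul_of_nonneg_left h5 (by positivity : 0 ≤ 2 * N ^ 2)
      rw [hprox]
      linarith
    · have hN : N = 0 := by simp only [N, hcase, norm_zero]
      rw [hN] at hpr ⊢
      linarith

/-- The regularized minimizers converge to the minimizer of least norm. -/
lemma IsProperConvexLsc.tendsto_regularizedMinimizer (hΦ : IsProperConvexLsc Φ)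
    (hmin : (argminSet Φ).Nonempty) {d l : ℝ} (hl : 0 ≤ l) (hld : l < d) :
    Tendsto (fun t : ℝ => regularizedMinimizer Φ (1 / t ^ d) (t ^ l)) atTop
      (𝓝 (minNormMinimizer Φ)) := by
  have h1 : Tendsto (fun t : ℝ => t ^ l + t ^ d) atTop atTop := by
    refine tendsto_atTop_mono' _ ?_ (tendsto_rpow_atTop (y := d) (by linarith))
    filter_upwards [eventually_gt_atTop 0] with t ht
    linarith [Real.rpow_pos_of_pos ht l]
  have h2 := (hΦ.tendsto_prox_zero hmin).comp h1
  have h3 : Tendsto (fun t : ℝ => 1 / (1 + polyLam l t * polyEps d t)) atTop (𝓝 1) := by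
    have h := ((tendsto_polyLam_mul_polyEps hld).const_add 1).inv₀ (by norm_num)
    simpa using h
  -- The minimizer is the product of a scalar tending to 1 and a proximal point of the origin whose
  -- index `λ + 1/ε` tends to infinity.
  have h4 := h3.smul h2
  rw [one_smul] at h4
  refine h4.congr' ?_
  filter_upwards [eventually_gt_atTop 0] with t ht
  have e := (hΦ.regularizedMinimizer_spec hmin (polyEps_pos d ht) (polyLam_pos l ht)).1
  rw [one_div_polyEps] at e
  exact e.symm

end Rates

end TikhonovFlow

/-! ### The main theorem -/

theorem mainTheorem3 {H : Type*} [NormedAddCommGroup H] [InnerProductSpace ℝ H] [CompleteSpace H]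
    (Φ : H → EReal) (hΦ : TikhonovFlow.IsProperConvexLsc Φ)
    (hmin : (TikhonovFlow.argminSet Φ).Nonempty)
    (α β t₀ d l : ℝ) (hα : 0 < α) (hβ : 0 < β) (ht₀ : 0 < t₀)
    (hd₁ : 1 ≤ d) (hd₂ : d < 2) (hl₀ : 0 ≤ l) (hld : l < d) :
    -- the conditions can be satisfied
    (∃ γ : ℝ, α / 2 < γ ∧ γ < α ∧ 2 * γ * (α - γ) < 1) ∧
    ((d = 1 → β < 1) → ∀ γ : ℝ, α / 2 < γ → γ < α → 2 * γ * (α - γ) < 1 →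
      ∃ a > 0, ∃ c > 0, TikhonovFlow.ParameterConditions
        (TikhonovFlow.polyLam l) (TikhonovFlow.polyEps d) α β γ a c) ∧
    -- the rates along every solution
    (∀ x : ℝ → H,
      TikhonovFlow.IsStrongSolution Φ (TikhonovFlow.polyLam l) (TikhonovFlow.polyEps d) α β t₀ x →
      (∀ γ : ℝ, α / 2 ≤ γ → γ < α → 2 * γ * (α - γ) < 1 →
        ∃ C₃ > 0, ∃ C₄ > 0, ∃ C₅ > 0, ∃ t₂ ≥ t₀, ∀ t ≥ t₂,
          TikhonovFlow.energy Φ (TikhonovFlow.polyLam l) (TikhonovFlow.polyEps d) β γ t₀ x t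
            ≤ C₃ / t ^ (d / 2 + 1) ∧
          TikhonovFlow.moreau Φ (t ^ l) (x t) - (⨅ y, Φ y).toReal
            ≤ C₃ / t ^ (d / 2 + 1)
              + 1 / (2 * t ^ d) * ‖TikhonovFlow.minNormMinimizer Φ‖ ^ 2 ∧
          Φ (TikhonovFlow.prox Φ (t ^ l) (x t)) - (⨅ y, Φ y)
            ≤ ((C₃ / t ^ (d / 2 + 1)
              + 1 / (2 * t ^ d) * ‖TikhonovFlow.minNormMinimizer Φ‖ ^ 2 : ℝ) : EReal) ∧
          ‖TikhonovFlow.prox Φ (t ^ l) (x t) - x t‖ ^ 2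
            ≤ 2 * C₃ * t ^ (l - d / 2 - 1)
              + t ^ (l - d) * ‖TikhonovFlow.minNormMinimizer Φ‖ ^ 2 ∧
          ‖x t - TikhonovFlow.regularizedMinimizer Φ (1 / t ^ d) (t ^ l)‖ ^ 2
            ≤ C₃ / t ^ (1 - d / 2) ∧
          TikhonovFlow.moreau Φ (t ^ l) (x t) - (⨅ y, Φ y).toReal ≤ C₄ / t ^ d ∧
          Φ (TikhonovFlow.prox Φ (t ^ l) (x t)) - (⨅ y, Φ y) ≤ ((C₄ / t ^ d : ℝ) : EReal) ∧
          ‖TikhonovFlow.prox Φ (t ^ l) (x t) - x t‖ ^ 2 ≤ C₅ / t ^ (d - l) ∧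
          (l ≤ 3 * d / 2 - 1 ∨ TikhonovFlow.minNormMinimizer Φ = 0 →
            ‖TikhonovFlow.prox Φ (t ^ l) (x t) - x t‖ ^ 2 ≤ C₅ / t ^ (d / 2 + 1 - l))) ∧
      Tendsto x atTop (𝓝 (TikhonovFlow.minNormMinimizer Φ))) := by
  have hrates : ∀ x : ℝ → H,
      TikhonovFlow.IsStrongSolution Φ (TikhonovFlow.polyLam l) (TikhonovFlow.polyEps d) α β t₀ x →
      ∀ γ : ℝ, α / 2 ≤ γ → γ < α → 2 * γ * (α - γ) < 1 → ∃ K > 0, ∃ t₂ ≥ t₀, 1 ≤ t₂ ∧ ∀ t ≥ t₂,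
        TikhonovFlow.energy Φ (TikhonovFlow.polyLam l) (TikhonovFlow.polyEps d) β γ t₀ x t
          ≤ K / t ^ (d / 2 + 1) ∧
        TikhonovFlow.regularized Φ (1 / t ^ d) (t ^ l) (x t)
          - TikhonovFlow.regularized Φ (1 / t ^ d) (t ^ l)
            (TikhonovFlow.regularizedMinimizer Φ (1 / t ^ d) (t ^ l)) ≤ K / t ^ (d / 2 + 1) := by
    intro x hx γ hγ1 hγ2 hγ3
    obtain ⟨K, hK, T, hT⟩ := hΦ.energy_le hmin hx hβ (by linarith : 0 < γ) hγ2 (by linarith) hl₀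
      hld.le hd₁ hd₂
    refine ⟨K, hK, max (max T 1) t₀, le_max_right _ _,
      (le_max_right _ _).trans (le_max_left _ _), fun t ht => ?_⟩
    have hE := hT t ((le_max_left _ _).trans ((le_max_left _ _).trans ht))
    refine ⟨hE, le_trans ?_ hE⟩
    exact le_add_of_nonneg_right (by positivity)
  refine ⟨TikhonovFlow.exists_gamma hα, fun hdβ γ hγ1 hγ2 hγ3 =>
    TikhonovFlow.parameterConditions hβ hd₁ hd₂ hl₀ hld hdβ hγ1 hγ2 hγ3, fun x hx => ⟨?_, ?_⟩⟩
  · intro γ hγ1 hγ2 hγ3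
    obtain ⟨K, hK, t₂, ht₂, h1, hE⟩ := hrates x hx γ hγ1 hγ2 hγ3
    -- The distance estimate costs a factor 2, because the quadratic growth of `φ` has coefficient
    -- `e / 2`; `2 * K` then serves all bounds with `C₃`.
    refine ⟨2 * K, by positivity, 2 * K + ‖TikhonovFlow.minNormMinimizer Φ‖ ^ 2, by positivity,
      4 * K + 2 * ‖TikhonovFlow.minNormMinimizer Φ‖ ^ 2, by positivity, t₂, ht₂, fun t ht => ?_⟩
    obtain ⟨hE1, hE2⟩ := hE t ht
    refine ⟨hE1.trans ?_, hΦ.rates_of_energy_le hmin (h1.trans ht) hK hd₂ hE2⟩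
    have : 0 < t ^ (d / 2 + 1) := Real.rpow_pos_of_pos (by linarith) _
    gcongr
    linarith
  -- Convergence does not involve `γ`, so any admissible value will do.
  · obtain ⟨γ, hγ1, hγ2, hγ3⟩ := TikhonovFlow.exists_gamma hα
    obtain ⟨K, hK, t₂, ht₂, h1, hE⟩ := hrates x hx γ hγ1.le hγ2 hγ3
    have hlim : Tendsto (fun t : ℝ => 2 * K / t ^ (1 - d / 2)) atTop (𝓝 0) :=
      tendsto_const_nhds.div_atTop (tendsto_rpow_atTop (by linarith))
    have hsq : Tendsto (fun t => ‖x t - TikhonovFlow.regularizedMinimizer Φ (1 / t ^ d) (t ^ l)‖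
        ^ 2) atTop (𝓝 0) := by
      refine squeeze_zero' (Eventually.of_forall fun _ => by positivity) ?_ hlim
      filter_upwards [eventually_ge_atTop t₂] with t ht
      exact (hΦ.rates_of_energy_le hmin (h1.trans ht) hK hd₂ (hE t ht).2).2.2.2.1
    have hn := hsq.sqrt
    simp only [Real.sqrt_sq (norm_nonneg _), Real.sqrt_zero] at hn
    have hsub := tendsto_zero_iff_norm_tendsto_zero.2 hn
    simpa using hsub.add (hΦ.tendsto_regularizedMinimizer hmin hl₀ hld)
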